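/- For $h\in\mathbb{Q}$ let $E_h(\mathbb{Q})$ be the set of rational points $[x:y:z]$ of the projective plane cubic $(x+z)(y+z)(x+y+z)=h\,xyz$, whose affine part is $(x+1)(y+1)(x+y+1)=h\,xy$. When this cubic is smooth, $E_h(\mathbb{Q})$ is an abelian group under the secant–tangent chord process with neutral element $\mathcal{O}=[1:-1:0]$: three points $P,Q,R$ satisfy $P+Q+R=\mathcal{O}$ if and only if they are the intersection points, counted with multiplicity, of the cubic with a line. Let $h_c^+=(11+5\sqrt5)/2\simeq 11.09$. Then: 1. there exist rational values $h>h_c^+$ for which $E_h(\mathbb{Q})$ has rank $0$; 2. for example, $13>h_c^+$, the group $E_{13}(\mathbb{Q})$ has rank $0$, and $E_{13}(\mathbb{Q})\cong\mathbb{Z}/5\mathbb{Z}$; 3. consequently the answer to the question of Bastien and Rogalski, "is the rank of $E_h(\mathbb{Q})$ positive for every $h\in\mathbb{Q}$ with $h>h_c^+$?", is negative. -/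

import Mathlib

open scoped LinearAlgebra.Projectivization

namespace Lyness

/-- The homogeneous form of `(x + 1) (y + 1) (x + y + 1) - h x y` in the coordinates
`[x : y : z] = [p 0 : p 1 : p 2]`. -/
def cubic (h : ℚ) (p : Fin 3 → ℚ) : ℚ :=
  (p 0 + p 2) * (p 1 + p 2) * (p 0 + p 1 + p 2) - h * p 0 * p 1 * p 2

theorem cubic_smul (h c : ℚ) (p : Fin 3 → ℚ) : cubic h (c • p) = c ^ 3 * cubic h p := by
  simp only [cubic, Pi.smul_apply, smul_eq_mul]
  ring

/-- The affine part `z = 1` is the curve `(x + 1) (y + 1) (x + y + 1) = h x y`. -/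
theorem cubic_affine (h x y : ℚ) :
    cubic h ![x, y, 1] = 0 ↔ (x + 1) * (y + 1) * (x + y + 1) = h * x * y := by
  simp [cubic, sub_eq_zero]

/-- `E h` is the set `E_h(ℚ)` of rational points of the projective cubic
`(x + z) (y + z) (x + y + z) = h x y z`. -/
def E (h : ℚ) : Type :=
  {P : ℙ ℚ (Fin 3 → ℚ) // ∀ p ∈ P.submodule, cubic h p = 0}

/-- The point `[1 : -1 : 0]` of `E_h`. -/
def O (h : ℚ) : E h :=
  ⟨Projectivization.mk ℚ ![1, -1, 0] (fun H => by simpa using congrFun H 0), by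
    intro p hp
    rw [Projectivization.submodule_mk, Submodule.mem_span_singleton] at hp
    obtain ⟨c, rfl⟩ := hp
    rw [cubic_smul]
    simp [cubic]⟩

/-- `LineMeets h P Q R`: some line of the projective plane over `ℚ` meets the cubic exactly in
`P`, `Q`, `R`, counted with multiplicity. The line is `{[s u + t v]}` with `u`, `v` linearly
independent, the three points have the parameters `[s : t] = [a 0 : a 1], [b 0 : b 1], [c 0 : c 1]`,
and the restriction of the cubic form to the line is a nonzero multiple of the product of the three
linear forms that vanish at these parameters. -/
def LineMeets (h : ℚ) (P Q R : E h) : Prop :=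
  ∃ u v : Fin 3 → ℚ, LinearIndependent ℚ ![u, v] ∧
    ∃ a b c : Fin 2 → ℚ, a ≠ 0 ∧ b ≠ 0 ∧ c ≠ 0 ∧
      a 0 • u + a 1 • v ∈ P.1.submodule ∧
      b 0 • u + b 1 • v ∈ Q.1.submodule ∧
      c 0 • u + c 1 • v ∈ R.1.submodule ∧
      ∃ k : ℚ, k ≠ 0 ∧ ∀ s t : ℚ, cubic h (s • u + t • v) =
        k * (s * a 1 - t * a 0) * (s * b 1 - t * b 0) * (s * c 1 - t * c 0)

/-- An abelian group structure on `E_h(ℚ)` is given by the secant-tangent chord process when its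
neutral element is `[1 : -1 : 0]` and three points add up to zero if and only if they are the
intersection of the cubic with a line. -/
def IsChordTangentLaw (h : ℚ) (G : AddCommGroup (E h)) : Prop :=
  (0 : E h) = O h ∧ ∀ P Q R : E h, P + Q + R = 0 ↔ LineMeets h P Q R

/-- There is at most one such group structure. -/
theorem IsChordTangentLaw.unique {h : ℚ} {G₁ G₂ : AddCommGroup (E h)}
    (h₁ : IsChordTangentLaw h G₁) (h₂ : IsChordTangentLaw h G₂) : G₁ = G₂ := by
  have key : ∀ P Q R : E h, G₁.add (G₁.add P Q) R = G₁.zero ↔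
      G₂.add (G₂.add P Q) R = G₂.zero := fun P Q R => (h₁.2 P Q R).trans (h₂.2 P Q R).symm
  have hz : G₁.zero = G₂.zero := h₁.1.trans h₂.1.symm
  have hneg : ∀ P : E h, G₁.neg P = G₂.neg P := by
    intro P
    have e1 : G₁.add (G₁.add P (G₁.neg P)) G₁.zero = G₁.zero := by
      let _ := G₁
      change P + -P + 0 = 0
      simp
    have e2 := (key _ _ _).1 e1
    rw [hz] at e2
    let _ := G₂
    change P + G₁.neg P + 0 = 0 at e2
    change G₁.neg P = -P
    rw [add_zero] at e2
    exact (neg_eq_of_add_eq_zero_right e2).symm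
  apply AddCommGroup.ext
  funext P Q
  have e1 : G₁.add (G₁.add P Q) (G₁.neg (G₁.add P Q)) = G₁.zero := by
    let _ := G₁
    exact add_neg_cancel (P + Q)
  have e2 := (key _ _ _).1 e1
  rw [hneg] at e2
  change G₁.add P Q = G₂.add P Q
  let _ := G₂
  change P + Q + -(G₁.add P Q) = 0 at e2
  exact (add_neg_eq_zero.1 e2).symm

/-- The value `h_c^+ = (11 + 5 √5) / 2`. -/
noncomputable def hcPlus : ℝ := (11 + 5 * Real.sqrt 5) / 2

end Lyness

/-! Put x₀ = x, x₁ = y. The Lyness recurrence xₙ₊₂ xₙ = 1 + xₙ₊₁ has period 5, and the affine curve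
is the locus x₀x₁x₂x₃x₄ = h of its cycles; the recurrence is translation by a rational point of
order 5. The heart of the matter is that for h = 13 no rational point has xy ≠ 0
(`eq_zero_of_curve`). This is an infinite descent back and forth along two dual 5-isogenies between
`E 13` and the quintic `Covering`.

From the curve to the covering (`exists_covering_of_cycle`): comparing numerators and denominators
in a rational cycle gives pairwise coprime integers d₁, …, d₅ with xᵢ₋₁ = dᵢ² / (dᵢ₊₂ dᵢ₊₃), indices
mod 5, apart from one factor 13. Up to order and sign they are the coordinates of an integral point
of the covering, and their product divides every common denominator of the cycle.

From the covering to the curve: the kernel μ₅ acts by `twist`, and the five twists of the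
hyperosculating section `flex` have product `a 0 ^ 5` up to constants (`Covering.flex_mul_prod`). In
the principal ideal domain ℤ[ζ₅] they are coprime away from 5, hence fifth powers up to units. The
unit is removed by a relation between conjugate units and by reduction modulo 13
(`Covering.exists_fifth_powers`). The fifth roots satisfy quadratic relations
(`Covering.exists_relations`), which produce a Lyness cycle of invariant 13 with a common
denominator m dividing `a 0` (`Covering.exists_recurrence`).

Composing the two steps replaces a point with `a 0 ≠ 0` by one whose coordinates have a nonzero
product dividing `a 0`, so |`a 0`| drops (`Covering.eq_zero`). Hence `E 13` consists of five obvious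
points. Its group structure is transported from ℤ/5, and the chord-tangent law becomes a finite
verification (`lineMeets_pt_iff`). The bound √5 < 3 puts 13 above h_c⁺. -/

namespace Lyness

/-! ### The covering quintic and its special hyperplane sections. -/

variable {R : Type*} [CommRing R]

/-- The quintic elliptic curve in `ℙ⁴` that covers `E 13` through an isogeny with kernel `μ₅`. -/
structure Covering (a : Fin 5 → R) : Prop where
  e0 : a 1 * a 4 - a 2 * a 3 - 13 * a 0 ^ 2 = 0
  e1 : a 2 ^ 2 - a 1 * a 3 + 13 * a 0 * a 4 = 0
  e2 : a 4 ^ 2 - a 1 * a 2 - a 0 * a 3 = 0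
  e3 : a 1 ^ 2 - a 3 * a 4 + a 0 * a 2 = 0
  e4 : a 3 ^ 2 - a 2 * a 4 - 13 * a 0 * a 1 = 0

/-- The action of a fifth root of unity on the covering. -/
def twist (w : R) (a : Fin 5 → R) : Fin 5 → R := fun j => w ^ (j : ℕ) * a j

theorem twist_zero (w : R) (a : Fin 5 → R) : twist w a 0 = a 0 := by simp [twist]
theorem twist_one (w : R) (a : Fin 5 → R) : twist w a 1 = w * a 1 := by simp [twist]
theorem twist_two (w : R) (a : Fin 5 → R) : twist w a 2 = w ^ 2 * a 2 := by simp [twist]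
theorem twist_three (w : R) (a : Fin 5 → R) : twist w a 3 = w ^ 3 * a 3 := by simp [twist]
theorem twist_four (w : R) (a : Fin 5 → R) : twist w a 4 = w ^ 4 * a 4 := by simp [twist]

/-- The hyperplane section that meets the covering five times in `[0 : 1 : 1 : 1 : 1]`. -/
def flex (a : Fin 5 → R) : R := 14 * a 0 + 5 * (a 1 - a 4) + 3 * (a 2 - a 3)

/-- A hyperplane section that meets the covering three times in `[0 : 1 : 1 : 1 : 1]`. -/
def tri (f : R) (a : Fin 5 → R) : R :=
  (6 + 4 * f) * a 0 + (1 + 2 * f) * (a 1 - a 4) + (1 + f) * (a 2 - a 3)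

/-- A hyperplane section that meets the covering twice in two conjugate points. -/
def dbl (f : R) (a : Fin 5 → R) : R := (5 * f - 3) * a 0 + f * (a 1 - a 4) + (a 2 - a 3)

/-- The hyperplanes with triple contact at [0 : 1 : 1 : 1 : 1] form a pencil, so three of them are
dependent. Once the sections are written through fifth roots, this becomes a quadratic relation.
Note that 2f - 1 is a square root of 5. -/
theorem flex_eq_tri {f : R} (hf : f ^ 2 - f - 1 = 0) (a : Fin 5 → R) :
    (2 * f - 1) * flex a = f ^ 2 * tri f a - (1 - f) ^ 2 * tri (1 - f) a := by
  simp only [flex, tri]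
  linear_combination ((4 - 8 * f) * a 0 + (2 - 4 * f) * a 1 + (1 - 2 * f) * a 2 + (-1 + 2 * f) * a
      3 + (-2 + 4 * f) * a 4) * hf

namespace Covering

variable {a : Fin 5 → R}

theorem map {S : Type*} [CommRing S] (h : Covering a) (g : R →+* S) :
    Covering (fun j => g (a j)) where
  e0 := by simpa [map_ofNat g 13] using congrArg g h.e0
  e1 := by simpa [map_ofNat g 13] using congrArg g h.e1
  e2 := by simpa using congrArg g h.e2
  e3 := by simpa using congrArg g h.e3
  e4 := by simpa [map_ofNat g 13] using congrArg g h.e4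

theorem twist (h : Covering a) {w : R} (hw : w ^ 5 = 1) : Covering (twist w a) := by
  constructor <;> simp only [twist_zero, twist_one, twist_two, twist_three, twist_four]
  · linear_combination h.e0 + (a 1 * a 4 - a 2 * a 3) * hw
  · linear_combination w ^ 4 * h.e1
  · linear_combination w ^ 3 * h.e2 + w ^ 3 * a 4 ^ 2 * hw
  · linear_combination w ^ 2 * h.e3 - w ^ 2 * a 3 * a 4 * hw
  · linear_combination w * h.e4 + w * (a 3 ^ 2 - a 2 * a 4) * hw

/-- Let Pᵢ = [0 : ζ^i : ζ^(2i) : ζ^(3i) : ζ^(4i)] and f = -(ζ² + ζ³). The sections have divisors 5P₀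
for `flex`, 3P₀ + P₂ + P₃ for `tri f`, P₀ + 2P₂ + 2P₃ for `dbl f` and P₀ + ⋯ + P₄ for `a 0`.
Replacing f by 1 - f exchanges {P₂, P₃} with {P₁, P₄}, and twisting by ζ^k shifts indices by -k.
This identity and the product identities below are equalities of divisors with the constant made
explicit. -/
theorem tri_sq (h : Covering a) {f : R} (hf : f ^ 2 - f - 1 = 0) :
    tri f a ^ 2 = (2 * f - 1) * (flex a * dbl f a) := by
  simp only [flex, tri, dbl]
  linear_combination (10 - 6 * f) * h.e0 + (5 - 3 * f) * h.e1 + (-5 + 3 * f) * h.e2 + (-5 + 3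
    * f) * h.e3 + (5 - 3 * f) * h.e4 + (-124 * a 0 ^ 2 - 62 * a 0 * a 1 - 22 * a 0 * a 2 + 22
    * a 0 * a 3 + 62 * a 0 * a 4 - 6 * a 1 ^ 2 - 2 * a 1 * a 2 + 2 * a 1 * a 3 + 12 * a 1 * a
    4 + a 2 ^ 2 - 2 * a 2 * a 3 + 2 * a 2 * a 4 + a 3 ^ 2 - 2 * a 3 * a 4 - 6 * a 4 ^ 2) * hf

theorem tri_mul_tri (h : Covering a) {f : R} (hf : f ^ 2 - f - 1 = 0) :
    tri f a * tri (1 - f) a = 5 * (a 0 * flex a) := by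
  simp only [flex, tri]
  linear_combination (2) * h.e0 + (1) * h.e1 + (-1) * h.e2 + (-1) * h.e3 + (1) * h.e4 + (-16 *
    a 0 ^ 2 - 16 * a 0 * a 1 - 8 * a 0 * a 2 + 8 * a 0 * a 3 + 16 * a 0 * a 4 - 4 * a 1 ^ 2 -
    4 * a 1 * a 2 + 4 * a 1 * a 3 + 8 * a 1 * a 4 - a 2 ^ 2 + 2 * a 2 * a 3 + 4 * a 2 * a 4 -
    a 3 ^ 2 - 4 * a 3 * a 4 - 4 * a 4 ^ 2) * hf

theorem dbl_mul_dbl (h : Covering a) {f : R} (hf : f ^ 2 - f - 1 = 0) :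
    dbl f a * dbl (1 - f) a = -5 * a 0 ^ 2 := by
  simp only [dbl]
  linear_combination (2) * h.e0 + (1) * h.e1 + (-1) * h.e2 + (-1) * h.e3 + (1) * h.e4 + (-25 *
    a 0 ^ 2 - 10 * a 0 * a 1 + 10 * a 0 * a 4 - a 1 ^ 2 + 2 * a 1 * a 4 - a 4 ^ 2) * hf

/-- Both sides have divisor 5(P₀ + P₂ + P₃). -/
theorem flex_mul_flex_mul_flex (h : Covering a) {z : R} (hz : 1 + z + z ^ 2 + z ^ 3 + z ^ 4 = 0) :
    25 * (flex a * Lyness.flex (Lyness.twist (z ^ 2) a) * Lyness.flex (Lyness.twist (z ^ 3) a)) =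
      (2 - (z ^ 2 + z ^ 3)) * (tri (-(z ^ 2 + z ^ 3)) a * dbl (-(z ^ 2 + z ^ 3)) a ^ 2) := by
  obtain ⟨f, hfz⟩ : ∃ f, f = -(z ^ 2 + z ^ 3) := ⟨_, rfl⟩
  have hf : f ^ 2 - f - 1 = 0 := by subst hfz; linear_combination (z ^ 2 + z - 1) * hz
  -- The product of the two twists is invariant under ζ ↦ ζ⁻¹, so its coefficients lie in ℤ[f].
  have key : Lyness.flex (Lyness.twist (z ^ 2) a) * Lyness.flex (Lyness.twist (z ^ 3) a) =
      196 * a 0 ^ 2 - 70 * f * a 0 * a 1 + (-42 + 42 * f) * a 0 * a 2 + (42 - 42 * f) * a 0 * a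
        3 + 70 * f * a 0 * a 4 + 25 * a 1 ^ 2 - 15 * f * a 1 * a 2 + (15 - 15 * f) * a 1 *
        a 3 + (25 - 25 * f) * a 1 * a 4 + 9 * a 2 ^ 2 + 9 * f * a 2 * a 3 + (15 - 15 * f)
        * a 2 * a 4 + 9 * a 3 ^ 2 - 15 * f * a 3 * a 4 + 25 * a 4 ^ 2 := by
    simp only [flex, twist_zero, twist_one, twist_two, twist_three, twist_four]
    rw [hfz]
    linear_combination ( (42 - 42 * z + 42 * z ^ 2) * a 0 * a 2 + (-42 + 42 * z - 42 * z ^ 2 +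
        42 * z ^ 4 - 42 * z ^ 5) * a 0 * a 3 + (70 * z ^ 2 - 70 * z ^ 4 + 70 * z ^ 7 - 70 * z ^ 8)
        * a 0 * a 4 + (-25 + 25 * z) * a 1 ^ 2 + (-15 * z ^ 2 + 15 * z ^ 4) * a 1 * a 2 + (-15 +
        15 * z - 15 * z ^ 2 + 15 * z ^ 4 - 15 * z ^ 5 + 15 * z ^ 6 - 15 * z ^ 7) * a 1 * a 3 +
        (-25 + 25 * z - 25 * z ^ 2 + 25 * z ^ 4 - 25 * z ^ 5 + 25 * z ^ 6 - 25 * z ^ 7 + 25 * z ^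
        9 - 25 * z ^ 10) * a 1 * a 4 + (-9 + 9 * z - 9 * z ^ 5 + 9 * z ^ 6) * a 2 ^ 2 + (9 * z ^ 2
        - 9 * z ^ 4 + 9 * z ^ 7 - 9 * z ^ 9) * a 2 * a 3 + (-15 + 15 * z - 15 * z ^ 2 + 15 * z ^ 4
        - 15 * z ^ 5 + 15 * z ^ 6 - 15 * z ^ 7 + 15 * z ^ 9 - 15 * z ^ 10 + 15 * z ^ 11 - 15 * z ^
        12) * a 2 * a 4 + (-9 + 9 * z - 9 * z ^ 5 + 9 * z ^ 6 - 9 * z ^ 10 + 9 * z ^ 11) * a 3 ^ 2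
        + (-15 * z ^ 2 + 15 * z ^ 4 - 15 * z ^ 7 + 15 * z ^ 9 - 15 * z ^ 12 + 15 * z ^ 14) * a 3 *
        a 4 + (-25 + 25 * z - 25 * z ^ 5 + 25 * z ^ 6 - 25 * z ^ 10 + 25 * z ^ 11 - 25 * z ^ 15 +
        25 * z ^ 16) * a 4 ^ 2 ) * hz
  rw [mul_assoc, key, ← hfz, show 2 - (z ^ 2 + z ^ 3) = 2 + f by rw [hfz]; ring]
  simp only [flex, tri, dbl]
  linear_combination ((-5242 + 34 * f) * a 0 + (-1859 + 1923 * f) * a 1 + (678 - 1791 * f) * a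
    2 + (-666 + 687 * f) * a 3 + (1821 + 1163 * f) * a 4) * h.e0 + ((-38 + 3086 * f) * a 0 +
    (1092 + 696 * f) * a 1 + (672 - 4 * f) * a 2 + (12 - 1104 * f) * a 3 + (12 - 1104 * f) * a
    4) * h.e1 + ((8492 + 5436 * f) * a 0 + (-1854 + 1908 * f) * a 1 + (-21 + 1842 * f) * a 2 +
    (38 - 3086 * f) * a 3 + (-3114 + 18 * f) * a 4) * h.e2 + ((8648 - 8916 * f) * a 0 + (3114
    - 18 * f) * a 1 + (1113 - 1146 * f) * a 3 + (1892 - 4994 * f) * a 4) * h.e3 + ((-672 + 4 *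
    f) * a 3) * h.e4 + ((-346 - 330 * f - 100 * f ^ 2) * a 0 ^ 3 + (-315 - 271 * f - 90 * f ^
    2) * a 0 ^ 2 * a 1 + (-220 - 110 * f - 25 * f ^ 2) * a 0 ^ 2 * a 2 + (220 + 110 * f + 25 *
    f ^ 2) * a 0 ^ 2 * a 3 + (315 + 271 * f + 90 * f ^ 2) * a 0 ^ 2 * a 4 + (-102 - 76 * f -
    24 * f ^ 2) * a 0 * a 1 ^ 2 + (-140 - 62 * f - 10 * f ^ 2) * a 0 * a 1 * a 2 + (140 + 62 *
    f + 10 * f ^ 2) * a 0 * a 1 * a 3 + (204 + 152 * f + 48 * f ^ 2) * a 0 * a 1 * a 4 + (-38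
    - 10 * f) * a 0 * a 2 ^ 2 + (76 + 20 * f) * a 0 * a 2 * a 3 + (140 + 62 * f + 10 * f ^ 2)
    * a 0 * a 2 * a 4 + (-38 - 10 * f) * a 0 * a 3 ^ 2 + (-140 - 62 * f - 10 * f ^ 2) * a 0 *
    a 3 * a 4 + (-102 - 76 * f - 24 * f ^ 2) * a 0 * a 4 ^ 2 + (-11 - 7 * f - 2 * f ^ 2) * a 1
    ^ 3 + (-21 - 8 * f - f ^ 2) * a 1 ^ 2 * a 2 + (21 + 8 * f + f ^ 2) * a 1 ^ 2 * a 3 + (33 +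
    21 * f + 6 * f ^ 2) * a 1 ^ 2 * a 4 + (-10 - 2 * f) * a 1 * a 2 ^ 2 + (20 + 4 * f) * a 1 *
    a 2 * a 3 + (42 + 16 * f + 2 * f ^ 2) * a 1 * a 2 * a 4 + (-10 - 2 * f) * a 1 * a 3 ^ 2 +
    (-42 - 16 * f - 2 * f ^ 2) * a 1 * a 3 * a 4 + (-33 - 21 * f - 6 * f ^ 2) * a 1 * a 4 ^ 2
    - a 2 ^ 3 + 3 * a 2 ^ 2 * a 3 + (10 + 2 * f) * a 2 ^ 2 * a 4 - 3 * a 2 * a 3 ^ 2 + (-20 -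
    4 * f) * a 2 * a 3 * a 4 + (-21 - 8 * f - f ^ 2) * a 2 * a 4 ^ 2 + a 3 ^ 3 + (10 + 2 * f)
    * a 3 ^ 2 * a 4 + (21 + 8 * f + f ^ 2) * a 3 * a 4 ^ 2 + (11 + 7 * f + 2 * f ^ 2) * a 4 ^
    3) * hf

/-- Both sides have divisor P₀ + P₁ + 3P₃ + 5P₄. Linking different twists, it later fixes a root of
unity that Galois symmetry alone leaves open. -/
theorem tri_twist_mul_dbl_twist (h : Covering a) {z : R}
    (hz : 1 + z + z ^ 2 + z ^ 3 + z ^ 4 = 0) :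
    tri (1 + (z ^ 2 + z ^ 3)) (Lyness.twist z a) *
        dbl (-(z ^ 2 + z ^ 3)) (Lyness.twist (z ^ 4) a) =
      (2 * -(z ^ 2 + z ^ 3) - 1) *
        (flex (Lyness.twist z a) * tri (-(z ^ 2 + z ^ 3)) (Lyness.twist (z ^ 2) a)) := by
  simp only [flex, tri, dbl, twist_zero, twist_one, twist_two, twist_three, twist_four]
  linear_combination (6 - 14 * z ^ 2 - 14 * z ^ 3) * h.e0 + (-7 - 12 * z - 8 * z ^ 2 + z ^ 3)
    * h.e1 + (-2 - 20 * z - 36 * z ^ 2 - 21 * z ^ 3) * h.e2 + (18 + 20 * z - z ^ 2 - 16 * z ^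
    3) * h.e3 + (5 + 12 * z + 13 * z ^ 2 + 4 * z ^ 3) * h.e4 + ((132 - 132 * z - 132 * z ^ 2)
    * a 0 ^ 2 + (65 + 112 * z + 6 * z ^ 2 - 112 * z ^ 3 - 52 * z ^ 4 - 4 * z ^ 5 - 4 * z ^ 6)
    * a 0 * a 1 + (-18 - 2 * z + 33 * z ^ 2 + 3 * z ^ 3 + 9 * z ^ 4 - 32 * z ^ 5 - 28 * z ^ 6
    + 4 * z ^ 7) * a 0 * a 2 + (-2 - 18 * z - 16 * z ^ 2 + 3 * z ^ 3 + 33 * z ^ 4 - 13 * z ^ 5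
    - 32 * z ^ 6 + 38 * z ^ 7 + 18 * z ^ 8 + 4 * z ^ 9 - 4 * z ^ 11) * a 0 * a 3 + (91 + 65 *
    z - 52 * z ^ 2 - 117 * z ^ 3 - 8 * z ^ 4 + 112 * z ^ 5 + 46 * z ^ 6 - 52 * z ^ 7 - 62 * z
    ^ 8 + 56 * z ^ 9 + 62 * z ^ 10 - 4 * z ^ 11 + 4 * z ^ 12 - 6 * z ^ 13 + 6 * z ^ 15 - 4 * z
    ^ 16 + 4 * z ^ 17 + 4 * z ^ 18) * a 0 * a 4 + (-18 - 2 * z + 21 * z ^ 2 + 20 * z ^ 3 - 21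
    * z ^ 4 - 18 * z ^ 5 - 2 * z ^ 6 - 2 * z ^ 7) * a 1 ^ 2 + (-2 - 18 * z - 16 * z ^ 2 + 15 *
    z ^ 3 + 24 * z ^ 4 - 23 * z ^ 6 - 11 * z ^ 7 + z ^ 8) * a 1 * a 2 + (-7 - 5 * z + 4 * z ^
    2 + 9 * z ^ 3 - z ^ 4 - 10 * z ^ 5 - 2 * z ^ 6 - z ^ 7 + 14 * z ^ 8 + 8 * z ^ 9 + 2 * z ^
    10 - 2 * z ^ 12) * a 1 * a 3 + (-6 + 6 * z + 14 * z ^ 2 - 14 * z ^ 4 - 6 * z ^ 5 + z ^ 6 +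
    19 * z ^ 7 - 19 * z ^ 9 + 22 * z ^ 10 + 21 * z ^ 11 - 2 * z ^ 12 + 2 * z ^ 13 - z ^ 14 + z
    ^ 16 - 2 * z ^ 17 + 2 * z ^ 18 + 2 * z ^ 19) * a 1 * a 4 + (7 + 5 * z - 4 * z ^ 2 - 9 * z
    ^ 3 + z ^ 4 + 7 * z ^ 5 + 8 * z ^ 6 - 7 * z ^ 7 - 6 * z ^ 8 + z ^ 9) * a 2 ^ 2 + (6 - 6 *
    z - 14 * z ^ 2 + 14 * z ^ 4 + 6 * z ^ 5 - 6 * z ^ 6 - 17 * z ^ 7 + 14 * z ^ 9 + 3 * z ^ 10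
    + z ^ 11 - z ^ 13) * a 2 * a 3 + (5 + 7 * z + z ^ 2 - 9 * z ^ 3 - 4 * z ^ 4 + 5 * z ^ 5 +
    7 * z ^ 6 + z ^ 7 - 14 * z ^ 8 + z ^ 9 - 3 * z ^ 10 + 10 * z ^ 11 + 13 * z ^ 12 - z ^ 13 +
    z ^ 14 - z ^ 15 + z ^ 17 - z ^ 18 + z ^ 19 + z ^ 20) * a 2 * a 4 + (-5 - 7 * z - z ^ 2 + 9
    * z ^ 3 + 4 * z ^ 4 - 5 * z ^ 5 - 7 * z ^ 6 - z ^ 7 + 9 * z ^ 8 + 7 * z ^ 9 - 8 * z ^ 10 -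
    4 * z ^ 11 - z ^ 12 + z ^ 14) * a 3 ^ 2 + (18 + 2 * z - 21 * z ^ 2 - 15 * z ^ 3 + 16 * z ^
    4 + 18 * z ^ 5 + 2 * z ^ 6 - 21 * z ^ 7 - 15 * z ^ 8 + 16 * z ^ 9 + 23 * z ^ 10 - 19 * z ^
    12 - 15 * z ^ 13 + z ^ 14 + z ^ 15 + z ^ 16 - z ^ 18 + z ^ 19 - z ^ 20 - z ^ 21) * a 3 * a
    4 + (2 + 18 * z + 16 * z ^ 2 - 15 * z ^ 3 - 21 * z ^ 4 + 2 * z ^ 5 + 18 * z ^ 6 + 16 * z ^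
    7 - 15 * z ^ 8 - 21 * z ^ 9 + 2 * z ^ 10 + 18 * z ^ 11 + 21 * z ^ 12 - 20 * z ^ 13 - 21 *
    z ^ 14 + 2 * z ^ 15 - 2 * z ^ 16 + z ^ 17 - z ^ 19 + 2 * z ^ 20 - 2 * z ^ 21 - 2 * z ^ 22)
    * a 4 ^ 2) * hz

/-- A hyperosculating hyperplane meets the covering in one point only. -/
theorem eq_of_flex_eq_zero [IsDomain R] (h : Covering a) {f : R} (hf : f ^ 2 - f - 1 = 0)
    (h5 : (5 : R) ≠ 0) (hH : flex a = 0) :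
    a 0 = 0 ∧ a 1 * (a 1 - a 2) = 0 ∧ a 2 * (a 1 - a 2) = 0 := by
  have hs : (2 * f - 1) * (2 * f - 1) = 5 := by linear_combination 4 * hf
  have hs0 : (2 * f - 1) ≠ 0 := fun h0 => h5 (by rw [← hs, h0, zero_mul])
  have hf' : (1 - f) ^ 2 - (1 - f) - 1 = 0 := by linear_combination hf
  -- By `tri_sq` both `tri f` and `tri (1 - f)` vanish with `flex`; these linear equations express
  -- a₁ - a₄ and a₂ - a₃ as multiples of a₀.
  have hL : tri f a = 0 := by
    have := h.tri_sq hf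
    rw [hH, zero_mul, mul_zero] at this
    exact pow_eq_zero_iff (two_ne_zero) |>.1 this
  have hL' : tri (1 - f) a = 0 := by
    have := h.tri_sq hf'
    rw [hH, zero_mul, mul_zero] at this
    exact pow_eq_zero_iff (two_ne_zero) |>.1 this
  have h1 : 4 * a 0 + 2 * (a 1 - a 4) + (a 2 - a 3) = 0 := by
    refine (mul_eq_zero.1 ?_).resolve_left hs0
    simp only [tri] at hL hL'
    linear_combination hL - hL'
  have h2 : 6 * a 0 + (a 1 - a 4) + (a 2 - a 3) = 0 := by
    simp only [tri] at hL
    linear_combination hL - f * h1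
  have h14 : a 1 = a 4 + 2 * a 0 := by linear_combination h1 - h2
  have h23 : a 2 = a 3 - 8 * a 0 := by linear_combination 2 * h2 - h1
  have e0 := h.e0
  have e1 := h.e1
  have e2 := h.e2
  have e3 := h.e3
  rw [h14, h23] at e0 e1 e2 e3
  have h0 : a 0 = 0 := by
    by_contra hne
    have hb : a 3 - a 4 - 5 * a 0 = 0 := by
      refine (mul_eq_zero.1 ?_).resolve_left hne
      linear_combination -2 * (e2 - e3) + (e0 - e2 + e1)
    have hb' : a 3 = a 4 + 5 * a 0 := by linear_combination hb
    rw [hb'] at e2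
    exact hne (pow_eq_zero_iff (two_ne_zero) |>.1 (by linear_combination e2))
  refine ⟨h0, ?_, ?_⟩
  · have := h.e3
    rw [h0] at this h14 h23
    rw [show a 3 = a 2 by linear_combination -h23,
      show a 4 = a 1 by linear_combination -h14] at this
    linear_combination this
  · have := h.e1
    rw [h0] at this h14 h23
    rw [show a 3 = a 2 by linear_combination -h23] at this
    linear_combination -this

end Covering

/-! ### The ring ℤ[ζ₅]. -/

open NumberField

/-- The properties of the ring `ℤ[ζ]` generated by a primitive fifth root of unity, and of its
automorphism `ζ ↦ ζ ^ 2`, that the descent uses. -/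
structure CyclotomicFive {R : Type*} [CommRing R] (z : R) (s : R ≃+* R) : Prop where
  sum : 1 + z + z ^ 2 + z ^ 3 + z ^ 4 = 0
  map : s z = z ^ 2
  repr : ∀ x : R, ∃ c₀ c₁ c₂ c₃ : ℤ, x = c₀ + c₁ * z + c₂ * z ^ 2 + c₃ * z ^ 3
  indep : ∀ c₀ c₁ c₂ c₃ : ℤ, (c₀ + c₁ * z + c₂ * z ^ 2 + c₃ * z ^ 3 : R) = 0 →
    c₀ = 0 ∧ c₁ = 0 ∧ c₂ = 0 ∧ c₃ = 0
  unit : ∀ x : R, IsUnit x → ∃ j : ℕ, s (s x) ^ 2 = z ^ j * x ^ 2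

theorem sum_pow_eq_zero {R : Type*} [CommRing R] [IsDomain R] {z : R}
    (hz : IsPrimitiveRoot z 5) : 1 + z + z ^ 2 + z ^ 3 + z ^ 4 = 0 := by
  have := hz.geom_sum_eq_zero (by norm_num)
  simpa [Finset.sum_range_succ] using this

/-- A ring homomorphism to `ℂ` carries the square of `ζ ↦ ζ ^ 2` to complex conjugation. -/
theorem norm_map_eq {K : Type*} [Field K] [NumberField K] [IsCyclotomicExtension {5} ℚ K] {z : K}
    (hz : IsPrimitiveRoot z 5) (t : K ≃ₐ[ℚ] K) (ht : t z = z ^ 2) (g : K →+* ℂ) (x : K) :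
    ‖g (t (t x))‖ = ‖g x‖ := by
  have key : (g.toRatAlgHom.comp (t.toAlgHom.comp t.toAlgHom)) =
      ((starRingEnd ℂ).comp g).toRatAlgHom := by
    refine PowerBasis.algHom_ext (hz.powerBasis ℚ) ?_
    have h5 : (g z) ^ 5 = 1 := by rw [← map_pow, hz.pow_eq_one, map_one]
    have hn : ‖g z‖ = 1 := Complex.norm_eq_one_of_pow_eq_one h5 (by norm_num)
    have hc : g z * (starRingEnd ℂ) (g z) = 1 := by
      rw [Complex.mul_conj, Complex.normSq_eq_norm_sq, hn]; norm_num
    have h0 : g z ≠ 0 := by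
      intro h0
      rw [h0, zero_mul] at hc
      exact zero_ne_one hc
    rw [IsPrimitiveRoot.powerBasis_gen]
    change g (t (t z)) = (starRingEnd ℂ) (g z)
    rw [ht, map_pow, ht, map_pow, map_pow]
    apply mul_left_cancel₀ h0
    rw [hc, ← h5]
    ring
  have := congrArg (fun f => f x) key
  change g (t (t x)) = (starRingEnd ℂ) (g x) at this
  rw [this, RCLike.norm_conj]

theorem exists_cyclotomicFive_ringOfIntegers (K : Type*) [Field K] [NumberField K]
    [IsCyclotomicExtension {5} ℚ K] : ∃ (z : 𝓞 K) (s : 𝓞 K ≃+* 𝓞 K), CyclotomicFive z s := by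
  have hz : IsPrimitiveRoot (IsCyclotomicExtension.zeta 5 ℚ K) 5 :=
    IsCyclotomicExtension.zeta_spec 5 ℚ K
  have hirr : Irreducible (Polynomial.cyclotomic 5 ℚ) :=
    Polynomial.cyclotomic.irreducible_rat (by norm_num)
  have hz2 : IsPrimitiveRoot (IsCyclotomicExtension.zeta 5 ℚ K ^ 2) 5 :=
    hz.pow_of_coprime 2 (by norm_num)
  let t : K ≃ₐ[ℚ] K := IsCyclotomicExtension.fromZetaAut hz2 hirr
  have ht : t (IsCyclotomicExtension.zeta 5 ℚ K) = IsCyclotomicExtension.zeta 5 ℚ K ^ 2 :=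
    IsCyclotomicExtension.fromZetaAut_spec hz2 hirr
  have hzi := hz.toInteger_isPrimitiveRoot
  let pb := hz.integralPowerBasis
  have hdim : pb.dim = 4 := by
    rw [IsPrimitiveRoot.integralPowerBasis_dim]
    decide
  have hgen : pb.gen = hz.toInteger := IsPrimitiveRoot.integralPowerBasis_gen hz
  let b : Module.Basis (Fin 4) ℤ (𝓞 K) := pb.basis.reindex (finCongr hdim)
  have hb : ∀ i : Fin 4, b i = hz.toInteger ^ (i : ℕ) := by
    intro i
    simp [b, hgen]
  refine ⟨hz.toInteger, RingOfIntegers.mapRingEquiv t.toRingEquiv, ?_, ?_, ?_, ?_, ?_⟩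
  · exact sum_pow_eq_zero hzi
  · ext
    exact ht
  · intro x
    have := b.sum_repr x
    rw [Fin.sum_univ_four] at this
    refine ⟨b.repr x 0, b.repr x 1, b.repr x 2, b.repr x 3, ?_⟩
    rw [hb, hb, hb, hb] at this
    simpa [zsmul_eq_mul] using this.symm
  · intro c₀ c₁ c₂ c₃ h
    have hl := Fintype.linearIndependent_iff.1 b.linearIndependent ![c₀, c₁, c₂, c₃] (by
      rw [Fin.sum_univ_four]
      simpa [hb, zsmul_eq_mul] using h)
    exact ⟨hl 0, hl 1, hl 2, hl 3⟩
  -- Since t ∘ t is complex conjugation in every embedding, t(t(u))/u has absolute value 1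
  -- everywhere, hence is a root of unity ±ζ^r by Kronecker. Squaring removes the sign.
  · intro x hx
    obtain ⟨u, rfl⟩ := hx
    have hu0 : ((u : 𝓞 K) : K) ≠ 0 := by
      simp
    let v : (𝓞 K)ˣ :=
      Units.map (RingOfIntegers.mapRingEquiv t.toRingEquiv).toRingHom.toMonoidHom
        (Units.map (RingOfIntegers.mapRingEquiv t.toRingEquiv).toRingHom.toMonoidHom u) * u⁻¹
    have hv : ((v : 𝓞 K) : K) * ((u : 𝓞 K) : K) = t (t ((u : 𝓞 K) : K)) := by
      rw [← map_mul, ← Units.val_mul]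
      simp only [v, inv_mul_cancel_right]
      rfl
    have hfin : IsOfFinOrder ((v : 𝓞 K) : K) := by
      rw [isOfFinOrder_iff_pow_eq_one]
      obtain ⟨n, hn, h⟩ := Embeddings.pow_eq_one_of_norm_eq_one K ℂ (x := ((v : 𝓞 K) : K))
        (RingOfIntegers.isIntegral_coe _) (by
          intro g
          have h1 := congrArg (fun y => ‖g y‖) hv
          simp only [map_mul, norm_mul] at h1
          rw [norm_map_eq hz t ht g] at h1
          exact mul_right_cancel₀ (by simp) (h1.trans (one_mul _).symm))
      exact ⟨n, hn, h⟩
    obtain ⟨r, -, hr⟩ := hz.exists_pow_or_neg_mul_pow_of_isOfFinOrder (by decide) hfin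
    refine ⟨2 * r, ?_⟩
    ext
    change (t (t ((u : 𝓞 K) : K))) ^ 2 = IsCyclotomicExtension.zeta 5 ℚ K ^ (2 * r) *
      ((u : 𝓞 K) : K) ^ 2
    rw [← hv]
    rcases hr with hr | hr <;> rw [hr] <;> ring

theorem exists_cyclotomicFive : ∃ (R : Type) (_ : CommRing R) (_ : IsDomain R)
    (_ : IsPrincipalIdealRing R) (z : R) (s : R ≃+* R), CyclotomicFive z s :=
  have : IsCyclotomicExtension {5} ℚ (CyclotomicField 5 ℚ) :=
    CyclotomicField.isCyclotomicExtension 5 ℚ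
  ⟨𝓞 (CyclotomicField 5 ℚ), inferInstance, inferInstance,
    IsCyclotomicExtension.Rat.five_pid _, exists_cyclotomicFive_ringOfIntegers _⟩

namespace CyclotomicFive

variable {R : Type*} [CommRing R] {z : R} {s : R ≃+* R}

theorem pow_five (h : CyclotomicFive z s) : z ^ 5 = 1 := by
  linear_combination (z - 1) * h.sum

theorem golden (h : CyclotomicFive z s) : (-(z ^ 2 + z ^ 3)) ^ 2 - -(z ^ 2 + z ^ 3) - 1 = 0 := by
  linear_combination (z ^ 2 + z - 1) * h.sum

theorem map_golden (h : CyclotomicFive z s) : s (-(z ^ 2 + z ^ 3)) = 1 - -(z ^ 2 + z ^ 3) := by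
  simp only [map_neg, map_add, map_pow, h.map]
  linear_combination (-z ^ 2 + z - 1) * h.sum

theorem intCast_eq_zero (h : CyclotomicFive z s) {n : ℤ} (hn : (n : R) = 0) : n = 0 :=
  (h.indep n 0 0 0 (by simp [hn])).1

theorem intCast_inj (h : CyclotomicFive z s) {m n : ℤ} (hn : (m : R) = n) : m = n :=
  sub_eq_zero.1 (h.intCast_eq_zero (by push_cast; exact sub_eq_zero.2 hn))

theorem dvd_of_intCast_dvd (h : CyclotomicFive z s) {m n : ℤ} (hmn : (m : R) ∣ n) : m ∣ n := by
  obtain ⟨x, hx⟩ := hmn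
  obtain ⟨c₀, c₁, c₂, c₃, rfl⟩ := h.repr x
  have := (h.indep (n - m * c₀) (-(m * c₁)) (-(m * c₂)) (-(m * c₃)) (by
    push_cast
    rw [hx]
    ring)).1
  exact ⟨c₀, by linarith⟩

/-- The automorphism `s` generates the Galois group, so its fixed ring is ℤ. This turns invariant
expressions into integers. -/
theorem exists_intCast_of_map_eq (h : CyclotomicFive z s) {x : R} (hx : s x = x) :
    ∃ n : ℤ, x = n := by
  obtain ⟨c₀, c₁, c₂, c₃, rfl⟩ := h.repr x
  simp only [map_add, map_mul, map_pow, h.map, map_intCast] at hx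
  obtain ⟨h0, h1, h2, h3⟩ := h.indep (-c₂) (c₃ - c₂ - c₁) (c₁ - c₂ - c₂) (-c₂ - c₃) (by
    push_cast
    linear_combination hx - (c₂ + c₃ * z * (z - 1)) * h.sum)
  have e2 : c₂ = 0 := by linarith
  have e3 : c₃ = 0 := by linarith
  have e1 : c₁ = 0 := by linarith
  exact ⟨c₀, by simp [e1, e2, e3]⟩

theorem exists_eq_mul_of_pow_eq [IsDomain R] (h : CyclotomicFive z s) {x y : R}
    (hxy : x ^ 5 = y ^ 5) : ∃ k : ℕ, x = z ^ k * y := by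
  have : (x - z ^ 0 * y) * (x - z ^ 1 * y) * (x - z ^ 2 * y) * (x - z ^ 3 * y) *
      (x - z ^ 4 * y) = 0 := by
    linear_combination hxy + (-x ^ 4 * y + (z + z ^ 3) * x ^ 3 * y ^ 2 -
      (z ^ 3 + z ^ 5) * x ^ 2 * y ^ 3 + z ^ 6 * x * y ^ 4 +
      (1 - z + z ^ 5 - z ^ 6) * y ^ 5) * h.sum
  simp only [mul_eq_zero, sub_eq_zero] at this
  rcases this with (((h0 | h0) | h0) | h0) | h0 <;> exact ⟨_, h0⟩

theorem one_sub_pow_dvd (h : CyclotomicFive z s) {k : ℕ} (hk : ¬ 5 ∣ k) : 1 - z ^ k ∣ 5 := by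
  -- The cofactor is (5 - Φ₅(w)) / (1 - w), where Φ₅(w) = 0.
  have key : ∀ w : R, 1 + w + w ^ 2 + w ^ 3 + w ^ 4 = 0 → 1 - w ∣ 5 := fun w hw =>
    ⟨4 + 3 * w + 2 * w ^ 2 + w ^ 3, by linear_combination hw⟩
  rw [← Nat.div_add_mod k 5, pow_add, pow_mul, h.pow_five, one_pow, one_mul]
  have hlt : k % 5 < 5 := Nat.mod_lt _ (by norm_num)
  have hne : k % 5 ≠ 0 := fun h0 => hk (Nat.dvd_of_mod_eq_zero h0)
  apply key
  have h5 := h.pow_five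
  have hs := h.sum
  interval_cases k % 5
  · exact absurd rfl hne
  · linear_combination hs
  · linear_combination hs + (z + z ^ 3) * h5
  · linear_combination hs + (z + z ^ 4 + z ^ 2 * (z ^ 5 + 1)) * h5
  · linear_combination hs + (z ^ 3 + z ^ 2 * (z ^ 5 + 1) + z * (z ^ 10 + z ^ 5 + 1)) * h5

theorem isUnit (h : CyclotomicFive z s) : IsUnit z :=
  IsUnit.of_mul_eq_one (z ^ 4) (by rw [← pow_succ', h.pow_five])

/-- The residue field at the inert prime `13` has `13 ^ 4` elements. -/
theorem thirteen_dvd_pow_sub (h : CyclotomicFive z s) (x : R) : (13 : R) ∣ x ^ 13 ^ 4 - x := by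
  have hnu : ((13 : ℕ) : R) ∈ nonunits R := by
    intro hu
    have := h.dvd_of_intCast_dvd (m := 13) (n := 1) (by
      simpa using hu.dvd)
    norm_num at this
  have : Fact (Nat.Prime 13) := ⟨by norm_num⟩
  have : CharP (R ⧸ Ideal.span {((13 : ℕ) : R)}) 13 := CharP.quotient R 13 hnu
  have hq : ((13 : ℕ) : R) ∣ x ^ 13 ^ 4 - x := by
    rw [← Ideal.mem_span_singleton, ← Ideal.Quotient.eq]
    obtain ⟨c₀, c₁, c₂, c₃, rfl⟩ := h.repr x
    -- As 13⁴ ≡ 1 mod 5, the fourth iterate of Frobenius fixes z; being a ring homomorphism, it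
    -- fixes every integral combination of powers of z.
    have hz : (Ideal.Quotient.mk (Ideal.span {((13 : ℕ) : R)}) z) ^ 13 ^ 4 =
        Ideal.Quotient.mk (Ideal.span {((13 : ℕ) : R)}) z := by
      rw [← map_pow]
      congr 1
      rw [show 13 ^ 4 = 5 * 5712 + 1 by norm_num, pow_succ, pow_mul, h.pow_five, one_pow, one_mul]
    rw [map_pow, ← iterateFrobenius_def]
    simp only [map_add, map_mul, map_pow, map_intCast, iterateFrobenius_def, hz]
  simpa using hq

theorem not_thirteen_dvd_five (h : CyclotomicFive z s) : ¬ (13 : R) ∣ 5 := by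
  intro hd
  have := h.dvd_of_intCast_dvd (m := 13) (n := 5) (by simpa using hd)
  norm_num at this

end CyclotomicFive

/-! ### The prime 5 and coprimality of the osculating sections. -/

/-- Over `ℤ₅` the covering has a single residue class. -/
theorem Covering.five_dvd {a : Fin 5 → ℤ} (h : Covering a) (hc : IsCoprime (a 1) (a 2)) :
    5 ∣ a 0 ∧ 5 ∣ a 3 - a 2 ∧ ¬ 5 ∣ a 2 := by
  have key : ∀ b0 b1 b2 b3 b4 : ZMod 5, b1 * b4 - b2 * b3 - 13 * b0 ^ 2 = 0 →
      b2 ^ 2 - b1 * b3 + 13 * b0 * b4 = 0 → b4 ^ 2 - b1 * b2 - b0 * b3 = 0 →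
      b1 ^ 2 - b3 * b4 + b0 * b2 = 0 → b3 ^ 2 - b2 * b4 - 13 * b0 * b1 = 0 →
      (b0 = 0 ∧ b3 - b2 = 0 ∧ b1 - b2 = 0) ∨
        (b2 - b1 - 3 * b0 = 0 ∧ b3 - b1 - 4 * b0 = 0 ∧ b4 - b1 - 2 * b0 = 0) := by
    decide +kernel
  have h5 := h.map (Int.castRingHom (ZMod 5))
  have hd : ∀ n : ℤ, (n : ZMod 5) = 0 → 5 ∣ n := fun n hn =>
    (ZMod.intCast_zmod_eq_zero_iff_dvd n 5).1 hn
  have main : 5 ∣ a 0 ∧ 5 ∣ a 3 - a 2 ∧ 5 ∣ a 1 - a 2 := by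
    rcases key _ _ _ _ _ h5.e0 h5.e1 h5.e2 h5.e3 h5.e4 with ⟨h0, h1, h2⟩ | ⟨h2, h3, h4⟩
    · simp only [eq_intCast, ← Int.cast_sub] at h0 h1 h2
      exact ⟨hd _ h0, hd _ h1, hd _ h2⟩
    -- The second family of solutions mod 5 is constrained by lifting to 25: a combination of the
    -- quadrics gives 25 ∣ 20 a₀², so 5 ∣ a₀ and the point falls into the first family after all.
    · obtain ⟨b2, h2⟩ := hd (a 2 - a 1 - 3 * a 0) (by push_cast; exact h2)
      obtain ⟨b3, h3⟩ := hd (a 3 - a 1 - 4 * a 0) (by push_cast; exact h3)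
      obtain ⟨b4, h4⟩ := hd (a 4 - a 1 - 2 * a 0) (by push_cast; exact h4)
      have e2 : a 2 = a 1 + 3 * a 0 + 5 * b2 := by linarith
      have e3 : a 3 = a 1 + 4 * a 0 + 5 * b3 := by linarith
      have e4 : a 4 = a 1 + 2 * a 0 + 5 * b4 := by linarith
      have hsq : 20 * (a 0) ^ 2 = -25 * (a 0 * b3 + 2 * (a 0 * b4) - b2 * b3 + b2 ^ 2 + b3 ^ 2 -
          b2 * b4) := by
        have := h.e0
        have := h.e1
        have := h.e4
        rw [e2, e3, e4] at *
        linarith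
      have h0 : 5 ∣ a 0 := by
        refine Int.Prime.dvd_pow' (p := 5) (k := 2) (by norm_num) ?_
        omega
      omega
  obtain ⟨h0, h1, h2⟩ := main
  refine ⟨h0, h1, fun h3 => ?_⟩
  have := hc.isUnit_of_dvd' (show 5 ∣ a 1 by omega) h3
  rw [Int.isUnit_iff] at this
  omega

section

variable {R : Type*} [CommRing R]

theorem flex_twist (w : R) (a : Fin 5 → R) : flex (twist w a) =
    14 * a 0 + 5 * (w * a 1 - w ^ 4 * a 4) + 3 * (w ^ 2 * a 2 - w ^ 3 * a 3) := by
  simp only [flex, twist_zero, twist_one, twist_two, twist_three, twist_four]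

theorem twist_twist (v w : R) (a : Fin 5 → R) : twist v (twist w a) = twist (v * w) a := by
  funext j
  simp only [twist, mul_pow]
  ring

theorem map_twist {S : Type*} [CommRing S] (g : R →+* S) (w : R) (a : Fin 5 → R) :
    (fun j => g (twist w a j)) = twist (g w) (fun j => g (a j)) := by
  funext j
  simp [twist]

theorem Covering.intCast {a : Fin 5 → ℤ} (h : Covering a) : Covering (fun j => (a j : R)) :=
  h.map (Int.castRingHom R)

theorem map_flex {S : Type*} [CommRing S] (g : R →+* S) (a : Fin 5 → R) :
    g (flex a) = flex (fun j => g (a j)) := by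
  simp [flex, map_ofNat g]

theorem map_tri {S : Type*} [CommRing S] (g : R →+* S) (f : R) (a : Fin 5 → R) :
    g (tri f a) = tri (g f) (fun j => g (a j)) := by
  simp [tri, map_ofNat g]

/-- Where the twist of a hyperosculating hyperplane meets the covering. -/
theorem Covering.eq_of_flex_twist_eq_zero [IsDomain R] {a : Fin 5 → R} (h : Covering a) {f : R}
    (hf : f ^ 2 - f - 1 = 0) (h5 : (5 : R) ≠ 0) {u v : R} (huv : u * a 1 + v * a 2 = 1) {w : R}
    (hw : w ^ 5 = 1) (hH : flex (Lyness.twist w a) = 0) : a 1 = w * a 2 := by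
  obtain ⟨-, h1, h2⟩ := (h.twist hw).eq_of_flex_eq_zero hf h5 hH
  simp only [twist_one, twist_two] at h1 h2
  linear_combination w ^ 3 * u * h1 + w ^ 2 * v * h2 + (w * a 2 - a 1) * huv -
    ((a 1 - w * a 2) * (u * a 1 + v * a 2)) * hw

end

section

variable {R : Type*} [CommRing R] {z : R} {s : R ≃+* R} {a : Fin 5 → ℤ}

/-- Distinct hyperosculating hyperplanes have no common factor outside `5`. -/
theorem CyclotomicFive.dvd_sub_of_dvd_flex (hz : CyclotomicFive z s) (h : Covering a)
    (hc : IsCoprime (a 1) (a 2)) {p : R} (hp : Prime p) (hp5 : ¬ p ∣ 5) {w w' : R} (hw : w ^ 5 = 1)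
    (hw' : w' ^ 5 = 1) (hd : p ∣ flex (twist w fun j => (a j : R)))
    (hd' : p ∣ flex (twist w' fun j => (a j : R))) : p ∣ w - w' := by
  obtain ⟨u, v, huv⟩ := hc
  have hpi : (Ideal.span {p}).IsPrime := (Ideal.span_singleton_prime hp.ne_zero).2 hp
  let g := Ideal.Quotient.mk (Ideal.span {p})
  have hg : ∀ x, g x = 0 ↔ p ∣ x := fun x => by
    rw [Ideal.Quotient.eq_zero_iff_mem, Ideal.mem_span_singleton]
  have hcov : Covering (fun j => g (a j : R)) := (h.intCast (R := R)).map g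
  have hf : (g (-(z ^ 2 + z ^ 3))) ^ 2 - g (-(z ^ 2 + z ^ 3)) - 1 = 0 := by
    have := congrArg g hz.golden
    simpa using this
  have h5 : (5 : R ⧸ Ideal.span {p}) ≠ 0 := by
    intro h5
    apply hp5
    rw [← hg, ← h5]
    exact map_ofNat g 5
  have huv' : g u * g (a 1) + g v * g (a 2) = 1 := by
    have := congrArg (Int.cast : ℤ → R) huv
    push_cast at this
    rw [← map_mul, ← map_mul, ← map_add, this, map_one]
  have key : ∀ y : R, y ^ 5 = 1 → p ∣ flex (twist y fun j => (a j : R)) →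
      g (a 1) = g y * g (a 2) := by
    intro y hy hyd
    refine hcov.eq_of_flex_twist_eq_zero hf h5 huv' (by rw [← map_pow, hy, map_one]) ?_
    rw [← map_twist, ← map_flex, hg]
    exact hyd
  have h1 := key w hw hd
  have h2 := key w' hw' hd'
  rw [← hg, map_sub]
  have h3 : g (a 2) * (g w - g w') = 0 := by linear_combination h2 - h1
  refine (mul_eq_zero.1 h3).resolve_left fun h0 => ?_
  rw [h0, mul_zero] at h1
  rw [h1, h0, mul_zero, mul_zero, add_zero] at huv'
  exact zero_ne_one huv'

/-- The conjugate hyperosculating hyperplane sections, divided by their common factor above `5`. -/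
theorem Covering.exists_flex_eq_mul (s : R ≃+* R) (h : Covering a)
    (hc : IsCoprime (a 1) (a 2)) : ∃ b : R → R,
      (∀ w, 1 + w + w ^ 2 + w ^ 3 + w ^ 4 = 0 →
        flex (Lyness.twist w fun j => (a j : R)) = (w ^ 2 - w ^ 3) * b w) ∧
      (∀ w, s (b w) = b (s w)) ∧
      ∀ w, 1 + w + w ^ 2 + w ^ 3 + w ^ 4 = 0 → ∀ p, Prime p → p ∣ 5 → ¬ p ∣ b w := by
  obtain ⟨⟨a0, h0⟩, ⟨c, h1⟩, h2⟩ := h.five_dvd hc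
  have h3 : a 3 = a 2 + 5 * c := by linarith
  -- For a primitive fifth root w, 5 = (w² - w³) · w³(4 + 3w + 2w² + w³). This divides the terms of
  -- `flex` that carry a factor 5; the remaining 3a₂(w² - w³) is divisible outright. A closed
  -- formula in w makes `b` commute with `s`.
  refine ⟨fun w => 3 * a 2 + w ^ 3 * (4 + 3 * w + 2 * w ^ 2 + w ^ 3) *
    (14 * a0 + w * a 1 - w ^ 4 * a 4 - 3 * w ^ 3 * c), ?_, ?_, ?_⟩
  · intro w hw
    rw [flex_twist, h0, h3]
    push_cast
    linear_combination ((70 - 70 * w + 14 * w ^ 5) * a0 + (5 * w - 5 * w ^ 2 + w ^ 6) * a 1 +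
      (-5 * w ^ 4 + 5 * w ^ 5 - w ^ 9) * a 4 + (-15 * w ^ 3 + 15 * w ^ 4 - 3 * w ^ 8) * c) * hw
  · intro w
    simp only [map_add, map_sub, map_mul, map_pow, map_intCast, map_ofNat]
  · intro w hw p hp hp5 hpb
    -- The square of the cofactor 5 / (w² - w³) is still divisible by 5, so p divides the cofactor
    -- and b(w) ≡ 3a₂ mod p.
    have hk : p ∣ w ^ 3 * (4 + 3 * w + 2 * w ^ 2 + w ^ 3) := by
      refine hp.dvd_of_dvd_pow (n := 2) (hp5.trans ⟨-2 + w ^ 2 + w ^ 3, ?_⟩)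
      linear_combination (10 - 10 * w - 5 * w ^ 2 + 5 * w ^ 4 + 10 * w ^ 5 + 6 * w ^ 6 +
        3 * w ^ 7 + w ^ 8) * hw
    have h3a : p ∣ ((3 * a 2 : ℤ) : R) := by
      push_cast
      exact (dvd_add_left (hk.mul_right _)).1 hpb
    have hcop : IsCoprime (3 * a 2) 5 := by
      refine IsCoprime.symm (((by norm_num : Prime (5 : ℤ)).coprime_iff_not_dvd).2 ?_)
      omega
    obtain ⟨x, y, hxy⟩ := hcop
    have : (x : R) * ((3 * a 2 : ℤ) : R) + y * 5 = 1 := by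
      exact_mod_cast congrArg (Int.cast : ℤ → R) hxy
    exact hp.not_isUnit (isUnit_of_dvd_one (this ▸ dvd_add (h3a.mul_left _) (hp5.mul_left _)))

end

section

variable {R : Type*} [CommRing R] [IsDomain R] {z : R} {a : Fin 5 → R}

/-- The constant in `flex_mul_flex_mul_flex` cancels because (z⁴ - z)(z - z⁴) = 2 - (z² + z³). -/
theorem Covering.flex_mul_eq (h : Covering a) (h5 : (5 : R) ≠ 0)
    (hz : 1 + z + z ^ 2 + z ^ 3 + z ^ 4 = 0) {b₂ b₃ : R}
    (h₂ : flex (Lyness.twist (z ^ 2) a) = (z ^ 4 - z) * b₂)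
    (h₃ : flex (Lyness.twist (z ^ 3) a) = (z - z ^ 4) * b₃) :
    25 * (flex a * b₂ * b₃) =
      tri (-(z ^ 2 + z ^ 3)) a * dbl (-(z ^ 2 + z ^ 3)) a ^ 2 := by
  have hs : (2 - (z ^ 2 + z ^ 3)) ≠ 0 := by
    intro h0
    apply h5
    linear_combination (3 + (z ^ 2 + z ^ 3)) * h0 + (z ^ 2 + z - 1) * hz
  apply mul_left_cancel₀ hs
  rw [← h.flex_mul_flex_mul_flex hz, h₂, h₃]
  linear_combination (50 - 50 * z - 25 * z ^ 3 + 25 * z ^ 4) * flex a * b₂ * b₃ * hz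

/-- Both sides have divisor 15P₀ + 5P₂ + 5P₃. It shows that a product of two conjugate sections is a
fifth power up to 5 · `flex`, which constrains the unit. -/
theorem Covering.tri_pow_five (h : Covering a) (h5 : (5 : R) ≠ 0)
    (hz : 1 + z + z ^ 2 + z ^ 3 + z ^ 4 = 0) {b₂ b₃ : R}
    (h₂ : flex (Lyness.twist (z ^ 2) a) = (z ^ 4 - z) * b₂)
    (h₃ : flex (Lyness.twist (z ^ 3) a) = (z - z ^ 4) * b₃) :
    tri (-(z ^ 2 + z ^ 3)) a ^ 5 = (5 * flex a) ^ 3 * (b₂ * b₃) := by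
  have hf : (-(z ^ 2 + z ^ 3)) ^ 2 - -(z ^ 2 + z ^ 3) - 1 = 0 := by
    linear_combination (z ^ 2 + z - 1) * hz
  have h1 := h.tri_sq hf
  have h2 := h.flex_mul_eq h5 hz h₂ h₃
  generalize -(z ^ 2 + z ^ 3) = f at *
  linear_combination (tri f a) * (tri f a ^ 2 + (2 * f - 1) * (flex a * dbl f a)) * h1 -
    (2 * f - 1) ^ 2 * flex a ^ 2 * h2 + 100 * flex a ^ 3 * b₂ * b₃ * hf

/-- Both sides have divisor 5(P₀ + ⋯ + P₄): multiply `flex_mul_eq` for z by the same identity for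
z². -/
theorem Covering.flex_mul_prod (h : Covering a) (h5 : (5 : R) ≠ 0)
    (hz : 1 + z + z ^ 2 + z ^ 3 + z ^ 4 = 0) {b₁ b₂ b₃ b₄ : R}
    (h₁ : flex (Lyness.twist z a) = (z ^ 2 - z ^ 3) * b₁)
    (h₂ : flex (Lyness.twist (z ^ 2) a) = (z ^ 4 - z) * b₂)
    (h₃ : flex (Lyness.twist (z ^ 3) a) = (z - z ^ 4) * b₃)
    (h₄ : flex (Lyness.twist (z ^ 4) a) = (z ^ 3 - z ^ 2) * b₄) (hH : flex a ≠ 0) :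
    5 * flex a * (b₁ * b₂ * b₃ * b₄) = a 0 ^ 5 := by
  have hf : (-(z ^ 2 + z ^ 3)) ^ 2 - -(z ^ 2 + z ^ 3) - 1 = 0 := by
    linear_combination (z ^ 2 + z - 1) * hz
  have hz5 : z ^ 5 = 1 := by linear_combination (z - 1) * hz
  have h1 := h.flex_mul_eq h5 hz h₂ h₃
  have h2 := h.flex_mul_eq (z := z ^ 2) (b₂ := b₄) (b₃ := b₁) h5
    (by linear_combination hz + (z + z ^ 3) * hz5)
    (by rw [← pow_mul, h₄]; linear_combination -z ^ 3 * b₄ * hz5)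
    (by rw [← pow_mul, show z ^ (2 * 3) = z by linear_combination z * hz5, h₁]
        linear_combination z ^ 3 * b₁ * hz5)
  rw [show -((z ^ 2) ^ 2 + (z ^ 2) ^ 3) = 1 - -(z ^ 2 + z ^ 3) by
    linear_combination -hz - z * hz5] at h2
  have h3 := h.tri_mul_tri hf
  have h4 := h.dbl_mul_dbl hf
  generalize -(z ^ 2 + z ^ 3) = f at *
  have h625 : (125 * flex a : R) ≠ 0 :=
    mul_ne_zero (by rw [show (125 : R) = 5 ^ 3 by norm_num]; exact pow_ne_zero 3 h5) hH
  apply mul_left_cancel₀ h625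
  linear_combination 25 * flex a * b₁ * b₄ * h1 + tri f a * dbl f a ^ 2 * h2 +
    (dbl f a * dbl (1 - f) a) ^ 2 * h3 +
    5 * a 0 * flex a * (dbl f a * dbl (1 - f) a - 5 * a 0 ^ 2) * h4

end

/-! ### Removing the unit: conjugation and reduction modulo 13. -/

section

variable {R : Type*} [CommRing R] {z : R} {s : R ≃+* R} {a : Fin 5 → ℤ}

theorem CyclotomicFive.five_ne_zero (hz : CyclotomicFive z s) : (5 : R) ≠ 0 := by
  intro h5
  have := hz.intCast_eq_zero (n := 5) (by exact_mod_cast h5)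
  norm_num at this

theorem CyclotomicFive.pow_eq_one_iff (hz : CyclotomicFive z s) {p : R} (hp : ¬ p ∣ 5) {k : ℕ}
    (hk : p ∣ 1 - z ^ k) : z ^ k = 1 := by
  by_contra hne
  have : ¬ 5 ∣ k := by
    rintro ⟨l, rfl⟩
    rw [pow_mul, hz.pow_five, one_pow] at hne
    exact hne rfl
  exact hp (hk.trans (hz.one_sub_pow_dvd this))

/-- Squaring the hypothesis and using that s²(x)² is x² up to a power of z gives y¹⁰ = z^j x⁴. Then
x = (x⁴)⁴ / x¹⁵ is a fifth power up to a power of z. -/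
theorem CyclotomicFive.eq_pow_five_of_unit (hz : CyclotomicFive z s) {x y : R} (hx : IsUnit x)
    (hxy : y ^ 5 = x * s (s x)) : ∃ (j : ℕ) (t : R), x = z ^ j * t ^ 5 := by
  obtain ⟨j, hj⟩ := hz.unit x hx
  obtain ⟨x', hx'⟩ := hx.exists_right_inv
  refine ⟨j, y ^ 8 * x' ^ 3, ?_⟩
  have h1 : y ^ 10 = z ^ j * x ^ 4 := by
    linear_combination (y ^ 5 + x * s (s x)) * hxy + x ^ 2 * hj
  calc x = (z ^ 5) ^ j * (x * (x * x') ^ 15) := by rw [hz.pow_five, hx', one_pow, one_pow]; ring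
    _ = z ^ j * (z ^ j * x ^ 4) ^ 4 * x' ^ 15 := by ring
    _ = z ^ j * (y ^ 8 * x' ^ 3) ^ 5 := by rw [← h1]; ring

/-- The covering modulo `13` is the nodal curve `[s ^ 5 - 1 : s : s ^ 2 : s ^ 3 : s ^ 4]`. -/
theorem Covering.not_thirteen_dvd (h : Covering a) (hc : IsCoprime (a 1) (a 2)) :
    ¬ (13 : ℤ) ∣ a 1 ∧ ¬ (13 : ℤ) ∣ a 2 := by
  have hp : Prime (13 : ℤ) := by norm_num
  have h0 := h.e0
  have h1 := h.e1
  have h3 := h.e3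
  have key : ¬ (13 : ℤ) ∣ a 1 := by
    intro h13
    have : (13 : ℤ) ∣ a 2 := by
      refine hp.dvd_of_dvd_pow (n := 2) ?_
      rw [show a 2 ^ 2 = a 1 * a 3 - 13 * (a 0 * a 4) by linarith]
      exact dvd_sub (h13.mul_right _) (dvd_mul_right _ _)
    exact hp.not_isUnit (hc.isUnit_of_dvd' h13 this)
  refine ⟨key, fun h13 => ?_⟩
  have h3' : (13 : ℤ) ∣ a 3 := by
    refine (hp.dvd_or_dvd (a := a 1) ?_).resolve_left key
    rw [show a 1 * a 3 = a 2 * a 2 + 13 * (a 0 * a 4) by linarith]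
    exact dvd_add (h13.mul_right _) (dvd_mul_right _ _)
  apply key
  refine hp.dvd_of_dvd_pow (n := 2) ?_
  rw [show a 1 ^ 2 = a 3 * a 4 - a 2 * a 0 by linarith]
  exact dvd_sub (h3'.mul_right _) (h13.mul_right _)

/-- The form is (x⁵ - y⁵)/(x - y), and 𝔽₁₃ has no fifth root of unity except 1, since 5 ∤ 12; for x
= y the value is 5y⁴. -/
theorem not_thirteen_dvd_sum {x y : ℤ} (hy : ¬ (13 : ℤ) ∣ y) :
    ¬ (13 : ℤ) ∣ x ^ 4 + x ^ 3 * y + x ^ 2 * y ^ 2 + x * y ^ 3 + y ^ 4 := by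
  have key : ∀ x y : ZMod 13, x ^ 4 + x ^ 3 * y + x ^ 2 * y ^ 2 + x * y ^ 3 + y ^ 4 = 0 →
      y = 0 := by decide
  intro hd
  apply hy
  rw [← Nat.cast_ofNat, ← ZMod.intCast_zmod_eq_zero_iff_dvd] at hd ⊢
  push_cast at hd
  exact key _ _ hd

theorem isUnit_intCast_of_not_dvd {S : Type*} [CommRing S] (h13 : (13 : S) = 0) {n : ℤ}
    (hn : ¬ (13 : ℤ) ∣ n) : IsUnit (n : S) := by
  obtain ⟨u, v, huv⟩ := ((by norm_num : Prime (13 : ℤ)).coprime_iff_not_dvd).2 hn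
  have := congrArg (Int.cast : ℤ → S) huv
  push_cast at this
  rw [h13, mul_zero, zero_add] at this
  exact IsUnit.of_mul_eq_one _ ((mul_comm _ _).trans this)

/-- On the nodal curve [s⁵ - 1 : s : s² : s³ : s⁴] the section `flex` becomes (s - 1)⁵ modulo 13, as
14 ≡ 1 and 3 ≡ -10. Twisting moves the root to z⁴, and s = a₂ / a₁. -/
theorem Covering.pow_five_eq_of_thirteen {a : Fin 5 → R} (h : Covering a) (h13 : (13 : R) = 0)
    (hz5 : z ^ 5 = 1) :
    (a 2 - z ^ 4 * a 1) ^ 5 = a 1 ^ 3 * a 2 * flex (Lyness.twist z a) := by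
  rw [flex_twist]
  linear_combination (5 * z ^ 4 * a 1 ^ 2 * a 2 - a 1 ^ 2 * a 3) * h.e0 + (-3 * z ^ 3 * a 1 ^ 2
    * a 2 - 5 * z ^ 4 * a 1 * a 2 ^ 2 + a 1 * a 2 * a 3 + a 2 ^ 3) * h.e1 + (-a 1 ^ 3) * h.e3
    + (5 * z ^ 4 * a 0 ^ 2 * a 1 ^ 2 * a 2 - a 0 ^ 2 * a 1 ^ 2 * a 3 - a 0 * a 1 ^ 3 * a 2 + 3
    * z ^ 3 * a 0 * a 1 ^ 2 * a 2 * a 4 + 5 * z ^ 4 * a 0 * a 1 * a 2 ^ 2 * a 4 - a 0 * a 1 *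
    a 2 * a 3 * a 4 - a 0 * a 2 ^ 3 * a 4 - z ^ 2 * a 1 ^ 3 * a 2 ^ 2 + z ^ 3 * a 1 ^ 2 * a 2
    ^ 3) * h13 + ((-1 - z ^ 5 - z ^ 10 - z ^ 15) * a 1 ^ 5 + (5 * z + 5 * z ^ 6 + 5 * z ^ 11)
    * a 1 ^ 4 * a 2 + (-10 * z ^ 2 - 10 * z ^ 7) * a 1 ^ 3 * a 2 ^ 2 + 10 * z ^ 3 * a 1 ^ 2 *
    a 2 ^ 3) * hz5

/-- In the residue field of order 13⁴ = 5 · 5712 + 1, raise `pow_five_eq_of_thirteen` to the power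
5712. Fifth powers become 1, as do a₁³ and a₂ (orders dividing 12) and z² - z³ (order dividing 112).
Only z^(5712 j) = 1 remains, and 5 ∤ 5712. -/
theorem CyclotomicFive.pow_eq_one_of_flex_twist_eq (hz : CyclotomicFive z s) (h : Covering a)
    (hc : IsCoprime (a 1) (a 2)) {j : ℕ} {t : R}
    (ht : flex (twist z fun j => (a j : R)) = (z ^ 2 - z ^ 3) * (z ^ j * t ^ 5)) : z ^ j = 1 := by
  obtain ⟨n1, n2⟩ := h.not_thirteen_dvd hc
  let g := Ideal.Quotient.mk (Ideal.span {(13 : R)})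
  have hg : ∀ x, g x = 0 ↔ (13 : R) ∣ x := fun x => by
    rw [Ideal.Quotient.eq_zero_iff_mem, Ideal.mem_span_singleton]
  have h13 : (13 : R ⧸ Ideal.span {(13 : R)}) = 0 := by
    rw [← map_ofNat g 13, hg]
  have hfrob : ∀ x : R, IsUnit (g x) → g x ^ 28560 = 1 := by
    intro x hx
    have h1 := (hg _).2 (hz.thirteen_dvd_pow_sub x)
    rw [map_sub, map_pow, show 13 ^ 4 = 28560 + 1 by norm_num, pow_succ, sub_eq_zero] at h1
    exact hx.mul_right_cancel (h1.trans (one_mul _).symm)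
  have hcov : Covering (fun j => g (a j : R)) := (h.intCast (R := R)).map g
  have hsum : 1 + g z + g z ^ 2 + g z ^ 3 + g z ^ 4 = 0 := by
    simpa using congrArg g hz.sum
  have hz5 : g z ^ 5 = 1 := by rw [← map_pow, hz.pow_five, map_one]
  have ht' := congrArg g ht
  rw [map_flex, map_twist] at ht'
  simp only [map_mul, map_sub, map_pow] at ht'
  have fermat : ∀ n : ℤ, ¬ (13 : ℤ) ∣ n → (n : R ⧸ Ideal.span {(13 : R)}) ^ 12 = 1 := by
    intro n hn
    have := Int.ModEq.pow_card_sub_one_eq_one (p := 13) (by norm_num)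
      (((by norm_num : Prime (13 : ℤ)).coprime_iff_not_dvd).2 hn).symm
    obtain ⟨k, hk⟩ := this.symm.dvd
    have := congrArg (Int.cast : ℤ → R ⧸ Ideal.span {(13 : R)}) hk
    push_cast at this
    rw [h13, zero_mul, sub_eq_zero] at this
    exact this
  have f1 := fermat _ n1
  have f2 := fermat _ n2
  -- The square of z² - z³ is f - 3, so its powers can be computed modulo 13 in ℤ[f] by repeated
  -- squaring; 112 = 64 + 32 + 16.
  have hpi : (g z ^ 2 - g z ^ 3) ^ 112 = 1 := by
    obtain ⟨f, hf⟩ : ∃ f, f = -(g z ^ 2 + g z ^ 3) := ⟨_, rfl⟩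
    have hff : f ^ 2 - f - 1 = 0 := by rw [hf]; linear_combination (g z ^ 2 + g z - 1) * hsum
    have p2 : (g z ^ 2 - g z ^ 3) ^ 2 = f - 3 := by
      rw [hf]
      linear_combination hsum + (g z - 2) * hz5
    generalize g z ^ 2 - g z ^ 3 = q at *
    have p4 : q ^ 4 = 10 - 5 * f := by
      linear_combination (q ^ 2 + f - 3) * p2 + hff
    have p8 : q ^ 8 = 3 * f - 5 := by
      linear_combination (q ^ 4 + (10 - 5 * f)) * p4 + 25 * hff + (10 - 6 * f) * h13
    have p16 : q ^ 16 = 5 * f + 8 := by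
      linear_combination (q ^ 8 + (3 * f - 5)) * p8 + 9 * hff + (2 - 2 * f) * h13
    have p32 : q ^ 32 = f + 11 := by
      linear_combination (q ^ 16 + (5 * f + 8)) * p16 + 25 * hff + (8 * f + 6) * h13
    have p64 : q ^ 64 = 10 * f + 5 := by
      linear_combination (q ^ 32 + (f + 11)) * p32 + hff + (f + 9) * h13
    have : q ^ 112 = q ^ 64 * q ^ 32 * q ^ 16 := by ring
    rw [this, p64, p32, p16]
    linear_combination (50 * f + 705) * hff + (150 * f + 88) * h13
  have hX : (g (a 2) - g z ^ 4 * g (a 1)) ^ 5 =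
      g (a 1) ^ 3 * g (a 2) * ((g z ^ 2 - g z ^ 3) * (g z ^ j * g t ^ 5)) := by
    rw [← ht']
    exact hcov.pow_five_eq_of_thirteen h13 hz5
  have hXu : IsUnit (g (a 2) - g z ^ 4 * g (a 1)) := by
    refine isUnit_of_mul_isUnit_left
      (y := (g (a 2) - g z * g (a 1)) * (g (a 2) - g z ^ 2 * g (a 1)) *
        (g (a 2) - g z ^ 3 * g (a 1))) ?_
    convert isUnit_intCast_of_not_dvd h13 (not_thirteen_dvd_sum (x := a 2) n1) using 1
    push_cast
    simp only [map_intCast]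
    linear_combination ((-1 + g z - g z ^ 5 + g z ^ 6) * (a 1 : R ⧸ Ideal.span {(13 : R)}) ^ 4 +
        (-1 + g z - g z ^ 5) * (a 1 : R ⧸ Ideal.span {(13 : R)}) ^ 3 * (a 2 : R ⧸ Ideal.span {(13 :
        R)}) + (-1 + g z + g z ^ 3) * (a 1 : R ⧸ Ideal.span {(13 : R)}) ^ 2 * (a 2 : R ⧸ Ideal.span
        {(13 : R)}) ^ 2 - 1 * (a 1 : R ⧸ Ideal.span {(13 : R)}) * (a 2 : R ⧸ Ideal.span {(13 : R)})
        ^ 3) * hsum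
  have hX1 := hfrob (a 2 - z ^ 4 * a 1) (by simpa using hXu)
  have htu : IsUnit (g t) := by
    have := hXu.pow 5
    rw [hX] at this
    exact (isUnit_pow_iff (by norm_num)).1 (isUnit_of_mul_isUnit_right
      (isUnit_of_mul_isUnit_right (isUnit_of_mul_isUnit_right this)))
  have ht1 := hfrob t htu
  refine hz.pow_eq_one_iff hz.not_thirteen_dvd_five ?_
  rw [← hg, map_sub, map_one, map_pow, sub_eq_zero]
  have f1' : g (a 1) ^ 12 = 1 := by rw [map_intCast, f1]
  have f2' : g (a 2) ^ 12 = 1 := by rw [map_intCast, f2]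
  have h1 : g z ^ (j * 5712) = 1 := by
    have h2 := congrArg (· ^ 5712) hX
    have h3 : (g (a 2) - g z ^ 4 * g (a 1)) ^ 28560 = 1 := by simpa using hX1
    simp only [mul_pow, ← pow_mul, Nat.reduceMul] at h2
    rwa [h3, ht1, show 17136 = 12 * 1428 by norm_num, pow_mul, f1', one_pow, one_mul,
      show g (a 2) ^ 5712 = (g (a 2) ^ 12) ^ 476 by rw [← pow_mul], f2', one_pow, one_mul,
      show (g z ^ 2 - g z ^ 3) ^ 5712 = ((g z ^ 2 - g z ^ 3) ^ 112) ^ 51 by rw [← pow_mul], hpi,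
      one_pow, one_mul, mul_one, eq_comm] at h2
  have h5 : ∀ n, g z ^ (5 * n) = 1 := fun n => by rw [pow_mul, hz5, one_pow]
  -- The exponent 3 inverts 5712 modulo 5.
  calc (1 : R ⧸ Ideal.span {(13 : R)}) = (g z ^ (j * 5712)) ^ 3 := by rw [h1, one_pow]
    _ = g z ^ (5 * (j * 3427)) * g z ^ j := by rw [← pow_mul, ← pow_add]; congr 1; ring
    _ = g z ^ j := by rw [h5, one_mul]

end

/-! ### Extracting fifth roots and their relations. -/

variable {R : Type*} [CommRing R] {z : R} {s : R ≃+* R} {a : Fin 5 → ℤ}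

theorem map_flex_twist (s : R ≃+* R) (w : R) (a : Fin 5 → ℤ) :
    s (flex (twist w fun j => (a j : R))) = flex (twist (s w) fun j => (a j : R)) := by
  have := map_flex (s : R →+* R) (twist w fun j => (a j : R))
  rw [map_twist] at this
  simpa using this

theorem map_tri_twist (s : R ≃+* R) (f w : R) (a : Fin 5 → ℤ) :
    s (tri f (twist w fun j => (a j : R))) = tri (s f) (twist (s w) fun j => (a j : R)) := by
  have := map_tri (s : R →+* R) f (twist w fun j => (a j : R))
  rw [map_twist] at this
  simpa using this

theorem one_twist {S : Type*} [CommRing S] (a : Fin 5 → S) : twist 1 a = a := by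
  funext j
  simp [twist]

theorem Covering.flex_ne_zero [IsDomain R] (hz : CyclotomicFive z s) (h : Covering a) (ha0 : a 0 ≠
    0) :
    flex (fun j => (a j : R)) ≠ 0 := by
  intro hH
  have := ((h.intCast (R := R)).eq_of_flex_eq_zero hz.golden hz.five_ne_zero hH).1
  exact ha0 (hz.intCast_eq_zero this)

/-- The hyperosculating hyperplane sections are fifth powers up to their common factors. -/
theorem Covering.exists_fifth_powers [IsDomain R] [IsPrincipalIdealRing R] (hz : CyclotomicFive z s)
    (h : Covering a) (hc : IsCoprime (a 1) (a 2)) (ha0 : a 0 ≠ 0) : ∃ (m : ℤ) (t : R),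
      5 * flex a = m ^ 5 ∧
      flex (Lyness.twist z fun j => (a j : R)) = (z ^ 2 - z ^ 3) * t ^ 5 := by
  have h5 := hz.five_ne_zero
  have hz5 := hz.pow_five
  have hsum := hz.sum
  obtain ⟨b, hb, hbs, hbp⟩ := h.exists_flex_eq_mul s hc
  have hsum2 : 1 + z ^ 2 + (z ^ 2) ^ 2 + (z ^ 2) ^ 3 + (z ^ 2) ^ 4 = 0 := by
    linear_combination hsum + (z + z ^ 3) * hz5
  have hsum3 : 1 + z ^ 3 + (z ^ 3) ^ 2 + (z ^ 3) ^ 3 + (z ^ 3) ^ 4 = 0 := by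
    linear_combination hsum + (z + z ^ 4 + z ^ 2 * (z ^ 5 + 1)) * hz5
  have hsum4 : 1 + z ^ 4 + (z ^ 4) ^ 2 + (z ^ 4) ^ 3 + (z ^ 4) ^ 4 = 0 := by
    linear_combination hsum + (z ^ 3 + z ^ 2 * (z ^ 5 + 1) + z * (z ^ 10 + z ^ 5 + 1)) * hz5
  have s2 : s (z ^ 2) = z ^ 4 := by rw [map_pow, hz.map]; ring
  have s4 : s (z ^ 4) = z ^ 3 := by
    rw [map_pow, hz.map]; linear_combination z ^ 3 * hz5
  have s3 : s (z ^ 3) = z := by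
    rw [map_pow, hz.map]; linear_combination z * hz5
  have h1 := hb z hsum
  have h2 : flex (Lyness.twist (z ^ 2) fun j => (a j : R)) = (z ^ 4 - z) * b (z ^ 2) := by
    rw [hb _ hsum2]; linear_combination -z * b (z ^ 2) * hz5
  have h3 : flex (Lyness.twist (z ^ 3) fun j => (a j : R)) = (z - z ^ 4) * b (z ^ 3) := by
    rw [hb _ hsum3]; linear_combination (z - z ^ 4) * b (z ^ 3) * hz5
  have h4 : flex (Lyness.twist (z ^ 4) fun j => (a j : R)) = (z ^ 3 - z ^ 2) * b (z ^ 4) := by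
    rw [hb _ hsum4]; linear_combination (z ^ 3 - z ^ 2 * (z ^ 5 + 1)) * b (z ^ 4) * hz5
  have hH := h.flex_ne_zero hz ha0
  have hcov := h.intCast (R := R)
  have hprod := hcov.flex_mul_prod h5 hsum h1 h2 h3 h4 hH
  have htri := hcov.tri_pow_five h5 hsum h2 h3
  have hcast : flex (fun j => (a j : R)) = ((flex a : ℤ) : R) := by
    simp [flex]
  have cop0 : ∀ w : R, 1 + w + w ^ 2 + w ^ 3 + w ^ 4 = 0 →
      IsCoprime (5 * flex (fun j => (a j : R))) (b w) := by
    intro w hw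
    refine isCoprime_of_prime_dvd (fun h0 => mul_ne_zero h5 hH h0.1) fun p hp hp1 hp2 => ?_
    by_cases hp5 : p ∣ 5
    · exact hbp w hw p hp hp5 hp2
    · have hd : p ∣ 1 - w := by
        refine hz.dvd_sub_of_dvd_flex h hc hp hp5 (one_pow 5) ?_ ?_ ?_
        · linear_combination (w - 1) * hw
        · rw [one_twist]
          exact (hp.dvd_or_dvd hp1).resolve_left hp5
        · rw [hb w hw]
          exact hp2.mul_left _
      exact hp5 (hd.trans ⟨4 + 3 * w + 2 * w ^ 2 + w ^ 3, by linear_combination hw⟩)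
  have cop : ∀ k : ℕ, 1 + z ^ (k + 1) + (z ^ (k + 1)) ^ 2 + (z ^ (k + 1)) ^ 3 +
      (z ^ (k + 1)) ^ 4 = 0 → ¬ 5 ∣ k → IsCoprime (b z) (b (z ^ (k + 1))) := by
    intro k hk hk5
    have hb0 : b z ≠ 0 := by
      intro h0
      rw [h0] at hprod
      simp only [zero_mul, mul_zero] at hprod
      exact ha0 (hz.intCast_eq_zero (pow_eq_zero_iff (by norm_num) |>.1 hprod.symm))
    refine isCoprime_of_prime_dvd (fun h0 => hb0 h0.1) fun p hp hp1 hp2 => ?_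
    by_cases hp5 : p ∣ 5
    · exact hbp z hsum p hp hp5 hp1
    · have hd : p ∣ z - z ^ (k + 1) := by
        refine hz.dvd_sub_of_dvd_flex h hc hp hp5 hz5 ?_ ?_ ?_
        · linear_combination (z ^ (k + 1) - 1) * hk
        · rw [hb z hsum]
          exact hp1.mul_left _
        · rw [hb _ hk]
          exact hp2.mul_left _
      rw [show z - z ^ (k + 1) = z * (1 - z ^ k) by ring] at hd
      rcases hp.dvd_or_dvd hd with hd | hd
      · exact hp.not_isUnit (isUnit_of_dvd_unit hd hz.isUnit)
      · exact hp5 (hd.trans (hz.one_sub_pow_dvd hk5))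
  -- This product is the norm of b(z), so 5 · `flex a` and n are coprime integers with product `a 0
  -- ^ 5`.
  obtain ⟨n, hn⟩ : ∃ n : ℤ, b z * b (z ^ 2) * b (z ^ 3) * b (z ^ 4) = n := by
    apply hz.exists_intCast_of_map_eq
    simp only [map_mul, hbs, s2, s3, s4, hz.map]
    ring
  obtain ⟨m, hm⟩ : ∃ m : ℤ, 5 * flex a = m ^ 5 := by
    refine Int.eq_pow_of_mul_eq_pow_odd_left (b := n) (c := a 0) ?_ (by decide) ?_
    · have hco : IsCoprime (((5 * flex a : ℤ)) : R) (n : R) := by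
        rw [← hn]
        push_cast
        rw [← hcast]
        exact (((cop0 z hsum).mul_right (cop0 _ hsum2)).mul_right (cop0 _ hsum3)).mul_right
          (cop0 _ hsum4)
      have hH' : flex a ≠ 0 := fun h0 => hH (by rw [hcast, h0, Int.cast_zero])
      refine isCoprime_of_prime_dvd (fun h0 => ?_) fun p hp hp1 hp2 => ?_
      · exact hH' ((mul_eq_zero.1 h0.1).resolve_left (by norm_num))
      · obtain ⟨u, v, huv⟩ := hco
        have hd : ((p : ℤ) : R) ∣ ((1 : ℤ) : R) := by
          rw [Int.cast_one, ← huv]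
          exact dvd_add ((Int.cast_dvd_cast _ _ hp1).mul_left _)
            ((Int.cast_dvd_cast _ _ hp2).mul_left _)
        exact hp.not_isUnit (isUnit_of_dvd_one (hz.dvd_of_intCast_dvd hd))
    · apply hz.intCast_inj
      push_cast
      rw [← hcast, ← hn, hprod]
  have hm' : 5 * flex (fun j => (a j : R)) = (m : R) ^ 5 := by
    rw [hcast]
    exact_mod_cast congrArg (Int.cast : ℤ → R) hm
  have hm0 : (m : R) ≠ 0 := by
    intro h0
    rw [h0] at hm'
    exact mul_ne_zero h5 hH (by rw [hm']; norm_num)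
  obtain ⟨d, hd⟩ : ∃ d : R, Associated (d ^ 5) (b z) := by
    refine exists_associated_pow_of_mul_eq_pow'
      (b := 5 * flex (fun j => (a j : R)) * b (z ^ 2) * b (z ^ 3) * b (z ^ 4)) (c := (a 0 : R))
      ?_ ?_
    · exact (((cop0 z hsum).symm.mul_right (cop 1 hsum2 (by norm_num))).mul_right
        (cop 2 hsum3 (by norm_num))).mul_right (cop 3 hsum4 (by norm_num))
    · rw [← hprod]; ring
  obtain ⟨u, hu⟩ := hd
  have hb0 : b z ≠ 0 := by
    intro h0
    rw [h0] at hprod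
    simp only [zero_mul, mul_zero] at hprod
    exact ha0 (hz.intCast_eq_zero (pow_eq_zero_iff (by norm_num) |>.1 hprod.symm))
  have hd0 : d ≠ 0 := by
    rintro rfl
    exact hb0 (by rw [← hu]; simp)
  have e2 : b (z ^ 2) = s (b z) := by rw [hbs, hz.map]
  have e3 : b (z ^ 3) = s (s (s (b z))) := by rw [hbs, hbs, hbs, hz.map, s2, s4]
  rw [hm', e2, e3, ← hu] at htri
  simp only [map_mul, map_pow] at htri
  -- Here b(z) = u d⁵. Comparing with the fifth power `tri ^ 5` shows that s(u) s³(u) is a fifth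
  -- power; applying s⁻¹ gives the hypothesis of `eq_pow_five_of_unit`.
  have hpow : tri (-(z ^ 2 + z ^ 3)) (fun j => (a j : R)) ^ 5 =
      (m ^ 3 * s d * s (s (s d))) ^ 5 * (s u * s (s (s u))) := by
    rw [htri]; ring
  obtain ⟨y, hy⟩ := (IsIntegrallyClosed.pow_dvd_pow_iff (n := 5) (by norm_num)).1
    (Dvd.intro _ hpow.symm)
  have hunit : s.symm y ^ 5 = (u : R) * s (s (u : R)) := by
    apply s.injective
    rw [map_pow, s.apply_symm_apply, map_mul]
    have h0 : (m ^ 3 * s d * s (s (s d))) ^ 5 ≠ 0 := by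
      refine pow_ne_zero 5 (mul_ne_zero (mul_ne_zero (pow_ne_zero 3 hm0) ?_) ?_) <;> simpa using hd0
    apply mul_left_cancel₀ h0
    rw [← hpow, hy]
    ring
  obtain ⟨j, t, ht⟩ := hz.eq_pow_five_of_unit u.isUnit hunit
  have hbz : b z = z ^ j * (d * t) ^ 5 := by
    rw [← hu, ht]; ring
  refine ⟨m, d * t, hm, ?_⟩
  rw [hbz] at h1
  have hj := hz.pow_eq_one_of_flex_twist_eq h hc h1
  rw [h1, hj, one_mul]

variable {R : Type*} [CommRing R] {z : R} {s : R ≃+* R} {a : Fin 5 → ℤ}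

theorem CyclotomicFive.map_map_map_map (hz : CyclotomicFive z s) (x : R) :
    s (s (s (s x))) = x := by
  obtain ⟨c₀, c₁, c₂, c₃, rfl⟩ := hz.repr x
  have h16 : z ^ 16 = z := by linear_combination (z ^ 11 + z ^ 6 + z) * hz.pow_five
  simp only [map_add, map_mul, map_pow, hz.map, map_intCast, ← pow_mul, Nat.reduceMul]
  rw [h16, show z ^ 32 = (z ^ 16) ^ 2 by ring, show z ^ 48 = (z ^ 16) ^ 3 by ring, h16]

/-- The relations between the fifth roots of the hyperosculating hyperplane sections. -/
theorem Covering.exists_relations [IsDomain R] (hz : CyclotomicFive z s) (h : Covering a)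
    (ha0 : a 0 ≠ 0) {m : ℤ} {t : R} (hm : 5 * flex a = m ^ 5)
    (ht : flex (Lyness.twist z fun j => (a j : R)) = (z ^ 2 - z ^ 3) * t ^ 5) :
    m ≠ 0 ∧ m ∣ a 0 ∧
    (m : R) ^ 2 = -(2 * (z ^ 2 + z ^ 3) + 1) * ((z ^ 2 + z ^ 3) ^ 2 * s t * s (s (s t)) -
      (1 + (z ^ 2 + z ^ 3)) ^ 2 * t * s (s t)) ∧
    (z ^ 2 - z ^ 3) * t ^ 2 = -(z ^ 2 + z ^ 3) ^ 2 * (z ^ 2 - z ^ 3) * s (s t) * s (s (s t)) +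
      (1 + (z ^ 2 + z ^ 3)) ^ 2 * m * s t := by
  have h5 := hz.five_ne_zero
  have hz5 := hz.pow_five
  have hsum := hz.sum
  have hf := hz.golden
  have sf := hz.map_golden
  have hH := h.flex_ne_zero hz ha0
  have hcov := h.intCast (R := R)
  have s2 : s (z ^ 2) = z ^ 4 := by rw [map_pow, hz.map]; ring
  have s4 : s (z ^ 4) = z ^ 3 := by
    rw [map_pow, hz.map]; linear_combination z ^ 3 * hz5
  have s3 : s (z ^ 3) = z := by
    rw [map_pow, hz.map]; linear_combination z * hz5
  obtain ⟨A, hA⟩ : ∃ A : Fin 5 → R, A = fun j => (a j : R) := ⟨_, rfl⟩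
  have hfl : ∀ w, s (flex (Lyness.twist w A)) = flex (Lyness.twist (s w) A) := fun w => by
    rw [hA]; exact map_flex_twist s w a
  have htr : ∀ g w, s (tri g (Lyness.twist w A)) = tri (s g) (Lyness.twist (s w) A) :=
    fun g w => by rw [hA]; exact map_tri_twist s g w a
  have hA0 : A 0 ≠ 0 := by
    rw [hA]; exact fun h0 => ha0 (hz.intCast_eq_zero h0)
  have hsA0 : s (A 0) = A 0 := by rw [hA]; simp
  have hm' : 5 * flex A = (m : R) ^ 5 := by
    have : flex A = ((flex a : ℤ) : R) := by rw [hA]; simp [flex]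
    rw [this]
    exact_mod_cast congrArg (Int.cast : ℤ → R) hm
  rw [← hA] at hcov hH ht
  obtain ⟨t1, e1⟩ : ∃ x, x = t := ⟨_, rfl⟩
  obtain ⟨t2, e2⟩ : ∃ x, x = s t := ⟨_, rfl⟩
  obtain ⟨t4, e4⟩ : ∃ x, x = s (s t) := ⟨_, rfl⟩
  obtain ⟨t3, e3⟩ : ∃ x, x = s (s (s t)) := ⟨_, rfl⟩
  have st1 : s t1 = t2 := by rw [e1, e2]
  have st2 : s t2 = t4 := by rw [e2, e4]
  have st4 : s t4 = t3 := by rw [e4, e3]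
  have st3 : s t3 = t1 := by rw [e3, e1, hz.map_map_map_map]
  rw [← e3, ← e4, ← e2, ← e1]
  rw [← e1] at ht
  have h2 : flex (Lyness.twist (z ^ 2) A) = (z ^ 4 - z) * t2 ^ 5 := by
    have := congrArg s ht
    rw [hfl, hz.map, map_mul, map_sub, s2, s3, map_pow, st1] at this
    exact this
  have h4 : flex (Lyness.twist (z ^ 4) A) = (z ^ 3 - z ^ 2) * t4 ^ 5 := by
    have := congrArg s h2
    rw [hfl, s2, map_mul, map_sub, s4, hz.map, map_pow, st2] at this
    exact this
  have h3 : flex (Lyness.twist (z ^ 3) A) = (z - z ^ 4) * t3 ^ 5 := by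
    have := congrArg s h4
    rw [hfl, s4, map_mul, map_sub, s3, s2, map_pow, st4] at this
    exact this
  have hprod := hcov.flex_mul_prod h5 hsum ht h2 h3 h4 hH
  have htri := hcov.tri_pow_five h5 hsum h2 h3
  have htri1 : (2 - (z ^ 2 + z ^ 3)) * tri (-(z ^ 2 + z ^ 3)) (Lyness.twist z A) ^ 5 =
      125 * ((z ^ 2 - z ^ 3) * t1 ^ 5) ^ 3 * ((z - z ^ 4) * t3 ^ 5) *
        ((z ^ 3 - z ^ 2) * t4 ^ 5) := by
    have q1 := (hcov.twist hz5).tri_sq hf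
    have q2 := (hcov.twist hz5).flex_mul_flex_mul_flex hsum
    rw [twist_twist, twist_twist, show z ^ 2 * z = z ^ 3 by ring,
      show z ^ 3 * z = z ^ 4 by ring, h3, h4, ht] at q2
    rw [ht] at q1
    have hff : (2 * -(z ^ 2 + z ^ 3) - 1) ^ 2 = 5 := by linear_combination 4 * hf
    generalize tri (-(z ^ 2 + z ^ 3)) (Lyness.twist z A) = L at *
    generalize dbl (-(z ^ 2 + z ^ 3)) (Lyness.twist z A) = M at *
    linear_combination (2 - (z ^ 2 + z ^ 3)) * L * (L ^ 2 + (2 * -(z ^ 2 + z ^ 3) - 1) *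
      ((z ^ 2 - z ^ 3) * t1 ^ 5 * M)) * q1 - 5 * ((z ^ 2 - z ^ 3) * t1 ^ 5) ^ 2 * q2 +
      (2 - (z ^ 2 + z ^ 3)) * L * ((z ^ 2 - z ^ 3) * t1 ^ 5 * M) ^ 2 * hff
  have hlin := flex_eq_tri hf A
  have hlin1 := flex_eq_tri hf (Lyness.twist z A)
  have htt := (hcov.twist hz5).tri_mul_tri hf
  have hcross := hcov.tri_twist_mul_dbl_twist hsum
  have hsq4 := (hcov.twist (w := z ^ 4) (by rw [← pow_mul, mul_comm, pow_mul, hz5, one_pow])).tri_sq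
    hf
  have hL : s (tri (-(z ^ 2 + z ^ 3)) A) = tri (1 - -(z ^ 2 + z ^ 3)) A := by
    have := htr (-(z ^ 2 + z ^ 3)) 1
    rwa [map_one, one_twist, sf] at this
  have hL' : s (tri (1 - -(z ^ 2 + z ^ 3)) A) = tri (-(z ^ 2 + z ^ 3)) A := by
    have := htr (1 - -(z ^ 2 + z ^ 3)) 1
    rwa [map_one, one_twist, map_sub, map_one, sf, sub_sub_cancel] at this
  have hL2 : s (tri (1 - -(z ^ 2 + z ^ 3)) (Lyness.twist z A)) =
      tri (-(z ^ 2 + z ^ 3)) (Lyness.twist (z ^ 2) A) := by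
    rw [htr, map_sub, map_one, sf, sub_sub_cancel, hz.map]
  have hL4 : s (s (tri (-(z ^ 2 + z ^ 3)) (Lyness.twist z A))) =
      tri (-(z ^ 2 + z ^ 3)) (Lyness.twist (z ^ 4) A) := by
    rw [htr, sf, hz.map, htr, map_sub, map_one, sf, sub_sub_cancel, s2]
  have hs5 : (2 * (z ^ 2 + z ^ 3) + 1) ^ 2 = 5 := by linear_combination 4 * hf
  have hs50 : 2 * (z ^ 2 + z ^ 3) + 1 ≠ 0 := fun h0 => h5 (by rw [← hs5, h0]; ring)
  have hss5 : s (2 * (z ^ 2 + z ^ 3) + 1) = -(2 * (z ^ 2 + z ^ 3) + 1) := by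
    have : s (z ^ 2 + z ^ 3) = -1 - (z ^ 2 + z ^ 3) := by
      rw [map_neg] at sf
      linear_combination -sf
    rw [map_add, map_mul, this, map_ofNat, map_one]
    ring
  have hp0 : z ^ 2 - z ^ 3 ≠ 0 := by
    intro h0
    apply h5
    linear_combination (4 + 3 * z + 2 * z ^ 2 + z ^ 3) * (z ^ 3 * h0 + (z - 1) * hz5) + hsum
  have spow : ∀ k : ℕ, s (z ^ k) = z ^ k * z ^ k := fun k => by
    rw [map_pow, hz.map]; ring
  have hzk5 : ∀ k : ℕ, (z ^ k) ^ 5 = 1 := fun k => by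
    rw [← pow_mul, mul_comm, pow_mul, hz5, one_pow]
  -- Equality of fifth powers leaves an unknown factor z^k, which conjugation must exclude. Here
  -- both A 0 and m t₁t₂t₃t₄ are fixed by s, so z^(2k) = z^k.
  have hA0eq : A 0 = m * (t1 * t2 * t3 * t4) := by
    obtain ⟨k, hk⟩ := hz.exists_eq_mul_of_pow_eq (x := A 0) (y := m * (t1 * t2 * t3 * t4))
      (by linear_combination -hprod + t1 ^ 5 * t2 ^ 5 * t3 ^ 5 * t4 ^ 5 * hm')
    have hk' := congrArg s hk
    simp only [hsA0, map_mul, spow, st1, st2, st3, st4, map_intCast] at hk'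
    have : z ^ k = 1 := by
      apply mul_right_cancel₀ hA0
      linear_combination z ^ k * hk - hk'
    rw [hk, this, one_mul]
  have hA0' := hA0
  rw [hA0eq] at hA0'
  obtain ⟨hm0, ht0⟩ := mul_ne_zero_iff.1 hA0'
  obtain ⟨ht0, ht40⟩ := mul_ne_zero_iff.1 ht0
  obtain ⟨ht0, ht30⟩ := mul_ne_zero_iff.1 ht0
  obtain ⟨ht10, ht20⟩ := mul_ne_zero_iff.1 ht0
  have hm3 : (m : R) ^ 3 ≠ 0 := pow_ne_zero 3 hm0
  have hLeq : tri (-(z ^ 2 + z ^ 3)) A = m ^ 3 * (t2 * t3) := by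
    obtain ⟨k, hk⟩ := hz.exists_eq_mul_of_pow_eq (x := tri (-(z ^ 2 + z ^ 3)) A)
      (y := m ^ 3 * (t2 * t3)) (by rw [htri, hm']; ring)
    have hk' := congrArg (fun x => s (s x)) hk
    simp only [hL, hL', map_mul, spow, map_pow, st1, st2, st3, st4, map_intCast] at hk'
    rw [hk] at hk'
    -- The square of s fixes this `tri` and exchanges t₂ with t₃, so z^(4k) = z^k.
    have h3k : z ^ k * z ^ k * (z ^ k * z ^ k) = z ^ k := by
      apply mul_right_cancel₀ (mul_ne_zero hm3 (mul_ne_zero ht20 ht30))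
      linear_combination -hk'
    have : z ^ k = 1 := by
      linear_combination -h3k + ((z ^ k) ^ 2 + 1) * (hzk5 k - z ^ k * h3k)
    rw [hk, this, one_mul]
  have hLbeq : tri (1 - -(z ^ 2 + z ^ 3)) A = m ^ 3 * (t4 * t1) := by
    rw [← hL, hLeq]
    simp only [map_mul, map_pow, map_intCast, st2, st3]
  obtain ⟨k, hk⟩ := hz.exists_eq_mul_of_pow_eq
    (x := tri (-(z ^ 2 + z ^ 3)) (Lyness.twist z A))
    (y := (2 * (z ^ 2 + z ^ 3) + 1) * (z ^ 2 - z ^ 3) * (t1 ^ 3 * t3 * t4)) (by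
      have h2F : 2 - (z ^ 2 + z ^ 3) ≠ 0 := by
        intro h0
        apply h5
        linear_combination (3 + (z ^ 2 + z ^ 3)) * h0 + (z ^ 2 + z - 1) * hsum
      apply mul_left_cancel₀ h2F
      rw [htri1]
      linear_combination (-125 * z ^ 9 + 623 * z ^ 10 - 1238 * z ^ 11 + 1326 * z ^ 12 - 1115 * z ^
          13 + 979 * z ^ 14 - 240 * z ^ 15 - 920 * z ^ 16 + 1110 * z ^ 17 - 400 * z ^ 18 - 120 * z
          ^ 19 + 456 * z ^ 20 - 576 * z ^ 21 - 128 * z ^ 22 + 640 * z ^ 23 + 48 * z ^ 24 - 464 * z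
          ^ 25 - 16 * z ^ 26 + 192 * z ^ 27 - 32 * z ^ 29) *
        (t1 ^ 15 * t3 ^ 5 * t4 ^ 5) * hsum)
  have hL1b : z ^ k * tri (1 - -(z ^ 2 + z ^ 3)) (Lyness.twist z A) =
      (2 * (z ^ 2 + z ^ 3) + 1) * (m * (t1 ^ 3 * t2)) := by
    rw [twist_zero, hk, hA0eq, ht] at htt
    apply mul_left_cancel₀ (mul_ne_zero (mul_ne_zero hs50 hp0)
      (mul_ne_zero (mul_ne_zero (pow_ne_zero 3 ht10) ht30) ht40))
    linear_combination htt - (m * (t1 * t2 * t3 * t4) * ((z ^ 2 - z ^ 3) * t1 ^ 5)) * hs5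
  -- The twisted section is not fixed by s or s². Substituting its conjugates into
  -- `tri_twist_mul_dbl_twist` and `tri_sq` gives c⁴ = 1 for c = z^k, and c⁵ = 1 is known.
  have hk1 : z ^ k = 1 := by
    have hL2' := congrArg s hL1b
    have hL4' := congrArg (fun x => s (s x)) hk
    have hc5 := hzk5 k
    simp only [map_mul, spow, map_intCast, hss5, hL2, hL4] at hL2' hL4'
    simp only [map_pow, map_sub, map_neg, hss5, st1, st2, st3, st4, hz.map] at hL2' hL4'
    rw [h4, hL4'] at hsq4
    rw [ht, ← sub_neg_eq_add 1] at hcross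
    generalize tri (1 - -(z ^ 2 + z ^ 3)) (Lyness.twist z A) = L1 at *
    generalize dbl (-(z ^ 2 + z ^ 3)) (Lyness.twist (z ^ 4) A) = M4 at *
    generalize z ^ k = c at *
    have hc4 : c ^ 4 = 1 := by
      apply mul_right_cancel₀ (mul_ne_zero (mul_ne_zero (mul_ne_zero (pow_ne_zero 3 hs50)
        (pow_ne_zero 2 hp0)) hm0) (mul_ne_zero (mul_ne_zero (pow_ne_zero 5 ht10)
          (pow_ne_zero 3 ht20)) (pow_ne_zero 6 ht40)))
      have e : ((z ^ 2) ^ 2) ^ 2 - ((z ^ 2) ^ 2) ^ 3 = -(z ^ 2 - z ^ 3) := by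
        linear_combination (z ^ 3 - z ^ 7 - z ^ 2) * hz5
      have e' : c * c * (c * c) = c ^ 4 := by ring
      simp only [← pow_mul] at e hsq4
      norm_num only at e hsq4
      rw [e, e'] at hsq4
      linear_combination c ^ 2 * L1 * hsq4 -
        c ^ 2 * (2 * (z ^ 2 + z ^ 3) + 1) * ((z ^ 3 - z ^ 2) * t4 ^ 5) * hcross +
        (2 * (z ^ 2 + z ^ 3) + 1) ^ 2 * ((z ^ 3 - z ^ 2) * t4 ^ 5) * ((z ^ 2 - z ^ 3) * t1 ^ 5) *
          hL2' - c ^ 9 * ((2 * (z ^ 2 + z ^ 3) + 1) * (z ^ 2 - z ^ 3) * (t4 ^ 3 * t2 * t1)) ^ 2 *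
          hL1b - c ^ 4 * ((2 * (z ^ 2 + z ^ 3) + 1) ^ 3 * (z ^ 2 - z ^ 3) ^ 2 * m *
            (t1 ^ 5 * t2 ^ 3 * t4 ^ 6)) * hc5
    linear_combination hc5 - c * hc4
  rw [hk1, one_mul] at hk hL1b
  refine ⟨fun h0 => hm0 (by rw [h0, Int.cast_zero]), hz.dvd_of_intCast_dvd ⟨t1 * t2 * t3 * t4, ?_⟩,
    ?_, ?_⟩
  · rw [← hA0eq, hA]
  -- The last two relations are `flex_eq_tri`, untwisted and twisted by z, after cancelling m³ and
  -- t₁³ respectively.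
  · rw [hLeq, hLbeq] at hlin
    apply mul_left_cancel₀ (mul_ne_zero hs50 hm3)
    linear_combination -5 * hlin - (2 * (z ^ 2 + z ^ 3) + 1) * hm' +
      (m ^ 3 * ((z ^ 2 + z ^ 3) ^ 2 * t2 * t3 - (1 + (z ^ 2 + z ^ 3)) ^ 2 * t1 * t4)) * hs5
  · rw [hk, hL1b, ht] at hlin1
    apply mul_left_cancel₀ (mul_ne_zero hs50 (pow_ne_zero 3 ht10))
    linear_combination -hlin1

/-! ### From fifth roots to a Lyness cycle. -/

variable {R : Type*} [CommRing R] {z : R} {s : R ≃+* R} {a : Fin 5 → ℤ}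

/-- A point of the quintic elliptic curve that is dual to the covering yields a period of the
recurrence `y (n + 2) * y n = m ^ 2 + m * y (n + 1)`. -/
theorem recurrence_of_relations {f m g1 g2 g3 g4 : R} (hz : 1 + z + z ^ 2 + z ^ 3 + z ^ 4 = 0)
    (hf : f = -(z ^ 2 + z ^ 3)) (r0 : m ^ 2 = f * g2 * g3 + (1 - f) * g1 * g4)
    (r1 : g1 ^ 2 = f * g3 * g4 + (1 - f) ^ 3 * m * g2)
    (r2 : g2 ^ 2 = (1 - f) * g1 * g3 + f ^ 3 * m * g4)
    (r4 : g4 ^ 2 = f * g1 * g2 + (1 - f) ^ 3 * m * g3)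
    (r3 : g3 ^ 2 = (1 - f) * g2 * g4 + f ^ 3 * m * g1) :
    (2 * m + z ^ 3 * g1 + z * g2 + z ^ 4 * g3 + z ^ 2 * g4) *
        (2 * m + z ^ 2 * g1 + z ^ 4 * g2 + z * g3 + z ^ 3 * g4) =
      m ^ 2 + m * (2 * m + g1 + g2 + g3 + g4) := by
  have hz5 : z ^ 5 = 1 := by linear_combination (z - 1) * hz
  have hff : f ^ 2 - f - 1 = 0 := by rw [hf]; linear_combination (z ^ 2 + z - 1) * hz
  have h1 : z + z ^ 4 = f - 1 := by rw [hf]; linear_combination hz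
  linear_combination r0 + r1 + r2 + r3 + r4 +
    (2 * m * (g1 + g4) + g1 * g2 + g2 * g3 + g3 * g4) * hf +
    (2 * m * (g2 + g3) + g1 * g3 + g1 * g4 + g2 * g4) * h1 +
    (g1 ^ 2 + g2 ^ 2 + g3 ^ 2 + g4 ^ 2 + z ^ 2 * g1 * g2 + z * g1 * g3 + z * g1 * g4 +
      z ^ 3 * g2 * g3 + z * g2 * g4 + z ^ 2 * g3 * g4) * hz5 +
    m * ((f + 1) * (g1 + g4) + (2 - f) * (g2 + g3)) * hff

/-- Put gᵢ = (ζ^(2i) - ζ^(3i)) tᵢ, where tᵢ is the conjugate of t under ζ ↦ ζ^i. Then y(n) = 2m + Σᵢ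
ζ^(2ni) gᵢ is fixed by s, hence an integer. The quadrics are stable under gᵢ ↦ v^i gᵢ for v⁵ = 1, so
`recurrence_of_relations` gives every step of the recurrence. Summing over a period kills the gᵢ and
leaves 10m. -/
theorem Covering.exists_recurrence [IsDomain R] (hz : CyclotomicFive z s) (h : Covering a)
    (ha0 : a 0 ≠ 0) {m : ℤ} {t : R} (hm : 5 * flex a = m ^ 5)
    (ht : flex (Lyness.twist z fun j => (a j : R)) = (z ^ 2 - z ^ 3) * t ^ 5) :
    ∃ y : ℕ → ℤ, m ≠ 0 ∧ m ∣ a 0 ∧ (∀ n, y n * y (n + 2) = m ^ 2 + m * y (n + 1)) ∧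
      (∀ n, y (n + 5) = y n) ∧ y 0 + y 1 + y 2 + y 3 + y 4 = 10 * m := by
  obtain ⟨hm0, hma, h0, h1⟩ := h.exists_relations hz ha0 hm ht
  have hsum := hz.sum
  have hz5 := hz.pow_five
  have sf := hz.map_golden
  obtain ⟨g1, e1⟩ : ∃ x, x = (z ^ 2 - z ^ 3) * t := ⟨_, rfl⟩
  obtain ⟨g2, e2⟩ : ∃ x, x = (z ^ 4 - z) * s t := ⟨_, rfl⟩
  obtain ⟨g4, e4⟩ : ∃ x, x = (z ^ 3 - z ^ 2) * s (s t) := ⟨_, rfl⟩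
  obtain ⟨g3, e3⟩ : ∃ x, x = (z - z ^ 4) * s (s (s t)) := ⟨_, rfl⟩
  have sg1 : s g1 = g2 := by
    rw [e1, e2, map_mul, map_sub, map_pow, map_pow, hz.map]
    linear_combination -z * s t * hz5
  have sg2 : s g2 = g4 := by
    rw [e2, e4, map_mul, map_sub, map_pow, hz.map]
    linear_combination z ^ 3 * s (s t) * hz5
  have sg4 : s g4 = g3 := by
    rw [e4, e3, map_mul, map_sub, map_pow, map_pow, hz.map]
    linear_combination z * s (s (s t)) * hz5
  have sg3 : s g3 = g1 := by
    rw [e3, e1, map_mul, map_sub, map_pow, hz.map, hz.map_map_map_map]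
    linear_combination -z ^ 3 * t * hz5
  obtain ⟨f, hf⟩ : ∃ f, f = -(z ^ 2 + z ^ 3) := ⟨_, rfl⟩
  rw [← hf] at sf
  have sf' : s (1 - f) = f := by rw [map_sub, map_one, sf, sub_sub_cancel]
  have r0 : (m : R) ^ 2 = f * g2 * g3 + (1 - f) * g1 * g4 := by
    rw [h0, hf, e1, e2, e3, e4]
    linear_combination (-(2 * z ^ 4 + z ^ 5 + z ^ 7) * s t * s (s (s t)) - (-1 + z - 4 * z ^ 2
        - 2 * z ^ 4 - 3 * z ^ 5) * t * s (s t)) * hsum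
  have r1 : g1 ^ 2 = f * g3 * g4 + (1 - f) ^ 3 * m * g2 := by
    rw [hf, e1, e2, e3, e4]
    linear_combination (z ^ 2 - z ^ 3) * h1 -
      ((z ^ 5 - z ^ 6 - z ^ 7 + z ^ 8) * s (s t) * s (s (s t)) + (-z - z ^ 3 - 2 * z ^ 4 +
          z ^ 5 + 2 * z ^ 8 + z ^ 9) * m * s t) * hsum
  have r2 : g2 ^ 2 = (1 - f) * g1 * g3 + f ^ 3 * m * g4 := by
    have := congrArg s r1
    simp only [map_pow, map_add, map_mul, sf, sf', sg1, sg2, sg3, sg4, map_intCast] at this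
    linear_combination this
  have r4 : g4 ^ 2 = f * g1 * g2 + (1 - f) ^ 3 * m * g3 := by
    have := congrArg s r2
    simp only [map_pow, map_add, map_mul, sf, sf', sg1, sg2, sg3, sg4, map_intCast] at this
    linear_combination this
  have r3 : g3 ^ 2 = (1 - f) * g2 * g4 + f ^ 3 * m * g1 := by
    have := congrArg s r4
    simp only [map_pow, map_add, map_mul, sf, sf', sg1, sg2, sg3, sg4, map_intCast] at this
    linear_combination this
  have hw : ∀ n : ℕ, (z ^ (2 * n)) ^ 5 = 1 := fun n => by
    rw [← pow_mul, mul_comm, pow_mul, hz5, one_pow]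
  have hY : ∀ n : ℕ, ∃ y : ℤ, 2 * m + z ^ (2 * n) * g1 + (z ^ (2 * n)) ^ 2 * g2 +
      (z ^ (2 * n)) ^ 3 * g3 + (z ^ (2 * n)) ^ 4 * g4 = (y : R) := fun n => by
    refine hz.exists_intCast_of_map_eq ?_
    have sw : s (z ^ (2 * n)) = (z ^ (2 * n)) ^ 2 := by
      rw [map_pow, hz.map, ← pow_mul, ← pow_mul, mul_comm]
    have := hw n
    simp only [map_add, map_mul, map_pow s (z ^ (2 * n)), sw, sg1, sg2, sg3, sg4, map_intCast,
      map_ofNat]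
    generalize z ^ (2 * n) = w at *
    linear_combination (w * g1 + w ^ 3 * g3) * this
  choose y hy using hY
  refine ⟨y, hm0, hma, fun n => hz.intCast_inj ?_, fun n => hz.intCast_inj ?_,
    hz.intCast_inj ?_⟩
  · push_cast
    rw [← hy, ← hy, ← hy]
    have hw' := hw n
    rw [show z ^ (2 * (n + 2)) = z ^ (2 * n) * z ^ 4 by ring,
      show z ^ (2 * (n + 1)) = z ^ (2 * n) * z ^ 2 by ring]
    generalize z ^ (2 * n) = w at *
    have hv : (w * z ^ 2) ^ 5 = 1 := by linear_combination w ^ 5 * (z ^ 5 + 1) * hz5 + hw'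
    -- `recurrence_of_relations` is centred at the middle term: y(n + 1) belongs to v, and y(n), y(n
    -- + 2) to v z⁻² = v z³ and v z².
    obtain ⟨v, hv'⟩ : ∃ v, v = w * z ^ 2 := ⟨_, rfl⟩
    have hwv : w = v * z ^ 3 := by rw [hv']; linear_combination -w * hz5
    rw [← hv', show w * z ^ 4 = v * z ^ 2 by rw [hv']; ring, hwv]
    rw [← hv'] at hv
    have := recurrence_of_relations (m := (m : R)) (g1 := v * g1) (g2 := v ^ 2 * g2)
      (g3 := v ^ 3 * g3) (g4 := v ^ 4 * g4) hsum hf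
      (by linear_combination r0 - (f * g2 * g3 + (1 - f) * g1 * g4) * hv)
      (by linear_combination v ^ 2 * r1 - v ^ 2 * f * g3 * g4 * hv)
      (by linear_combination v ^ 4 * r2)
      (by linear_combination v ^ 8 * r4 + v ^ 3 * (f * g1 * g2 + (1 - f) ^ 3 * m * g3) * hv)
      (by linear_combination v ^ 6 * r3 + v * f ^ 3 * m * g1 * hv)
    rw [show 2 * m + v * z ^ 3 * g1 + (v * z ^ 3) ^ 2 * g2 + (v * z ^ 3) ^ 3 * g3 +
        (v * z ^ 3) ^ 4 * g4 = 2 * m + z ^ 3 * (v * g1) + z * (v ^ 2 * g2) + z ^ 4 * (v ^ 3 * g3) +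
          z ^ 2 * (v ^ 4 * g4) by
        linear_combination (v ^ 2 * z * g2 + v ^ 3 * z ^ 4 * g3 +
          v ^ 4 * (z ^ 7 + z ^ 2) * g4) * hz5,
      show 2 * m + v * z ^ 2 * g1 + (v * z ^ 2) ^ 2 * g2 + (v * z ^ 2) ^ 3 * g3 +
        (v * z ^ 2) ^ 4 * g4 = 2 * m + z ^ 2 * (v * g1) + z ^ 4 * (v ^ 2 * g2) + z * (v ^ 3 * g3) +
          z ^ 3 * (v ^ 4 * g4) by
        linear_combination (v ^ 3 * z * g3 + v ^ 4 * z ^ 3 * g4) * hz5, this]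
  · rw [← hy, ← hy, show z ^ (2 * (n + 5)) = z ^ (2 * n) * (z ^ 5) ^ 2 by ring, hz5, one_pow,
      mul_one]
  · push_cast
    rw [← hy, ← hy, ← hy, ← hy, ← hy]
    linear_combination ((1 - z + z ^ 2 - z ^ 3 + z ^ 4) * g1 + (1 - z + z ^ 4 - z ^ 6 + z ^
        8 - z ^ 11 + z ^ 12) * g2 + (1 - z + z ^ 5 - z ^ 7 + z ^ 10 - z ^ 13 + z ^ 15 - z ^ 19
        + z ^ 20) * g3 + (1 - z + z ^ 5 - z ^ 6 + z ^ 8 - z ^ 9 + z ^ 10 - z ^ 11 + z ^ 13 - z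
        ^ 14 + z ^ 15 - z ^ 17 + z ^ 18 - z ^ 19 + z ^ 20 - z ^ 22 + z ^ 23 - z ^ 27 + z ^ 28) *
        g4) * hsum

/-! ### From a Lyness cycle to a point of the covering. -/

/-- Here X/(hk) and Y/(gk) are x and y in lowest terms, k being the gcd of the denominators.
Coprimality lets each factor of the cleared equation be divided out in turn, and what remains of X
and Y is a square up to sign, apart from the 13 that sits in X. -/
theorem exists_square_parametrization {g h k X Y : ℤ} (hX : IsCoprime X (h * k))
    (hY : IsCoprime Y (g * k)) (hgh : IsCoprime g h) (X0 : X ≠ 0) (Y0 : Y ≠ 0) (g0 : g ≠ 0)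
    (h0 : h ≠ 0) (k0 : k ≠ 0) (h13 : 13 ∣ X)
    (E : (X + h * k) * (Y + g * k) * (g * X + h * Y + g * h * k) = 13 * X * Y * g * h * k) :
    ∃ a b e e' : ℤ, (e = 1 ∨ e = -1) ∧ (e' = 1 ∨ e' = -1) ∧ X = e' * (13 * b ^ 2) ∧
      Y = e * a ^ 2 ∧ X + h * k = g * a ∧ Y + g * k = h * (13 * b) ∧
      h ^ 2 + e' * (g * b) = e * e' * (k * a) ∧ g ^ 2 + e * (h * a) = e * e' * (13 * (k * b)) := by
  have p13 : Prime (13 : ℤ) := by norm_num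
  have hXh := hX.of_mul_right_left
  have hXk := hX.of_mul_right_right
  have hYg := hY.of_mul_right_left
  have hYk := hY.of_mul_right_right
  obtain ⟨S, hS⟩ : ∃ S, S = g * X + h * Y + g * h * k := ⟨_, rfl⟩
  rw [← hS] at E
  have hgS : IsCoprime g S := by
    rw [show S = h * Y + g * (X + h * k) by rw [hS]; ring]
    exact (hgh.mul_right hYg.symm).add_mul_left_right _
  have hhS : IsCoprime h S := by
    rw [show S = g * X + h * (Y + g * k) by rw [hS]; ring]
    exact (hgh.symm.mul_right hXh.symm).add_mul_left_right _
  have hgY' : IsCoprime g (Y + g * k) := hYg.symm.add_mul_left_right _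
  have hhX' : IsCoprime h (X + h * k) := hXh.symm.add_mul_left_right _
  obtain ⟨a, ha⟩ : g ∣ X + h * k := hgY'.dvd_of_dvd_mul_right
    (hgS.dvd_of_dvd_mul_right ⟨13 * X * Y * h * k, by rw [E]; ring⟩)
  obtain ⟨b₀, hb₀⟩ : h ∣ Y + g * k := hhX'.dvd_of_dvd_mul_left
    (hhS.dvd_of_dvd_mul_right ⟨13 * X * Y * g * k, by rw [E]; ring⟩)
  have E1 : a * b₀ * S = 13 * X * Y * k := by
    apply mul_left_cancel₀ (mul_ne_zero g0 h0)
    rw [ha, hb₀] at E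
    linear_combination E
  have hka : IsCoprime k a := by
    have : IsCoprime k (X + k * h) := hXk.symm.add_mul_left_right h
    rw [mul_comm k, ha] at this
    exact this.of_mul_right_right
  have hkb : IsCoprime k b₀ := by
    have : IsCoprime k (Y + k * g) := hYk.symm.add_mul_left_right g
    rw [mul_comm k, hb₀] at this
    exact this.of_mul_right_right
  have hXa : IsCoprime X a := by
    have : IsCoprime X (h * k + X * 1) := hX.add_mul_left_right 1
    rw [mul_one, add_comm, ha] at this
    exact this.of_mul_right_right
  have hYb : IsCoprime Y b₀ := by
    have : IsCoprime Y (g * k + Y * 1) := hY.add_mul_left_right 1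
    rw [mul_one, add_comm, hb₀] at this
    exact this.of_mul_right_right
  obtain ⟨S₁, hS₁⟩ : k ∣ S := (hka.mul_right hkb).dvd_of_dvd_mul_left ⟨13 * X * Y, by rw [E1]; ring⟩
  have E2 : a * b₀ * S₁ = 13 * X * Y := by
    apply mul_left_cancel₀ k0
    rw [hS₁] at E1
    linear_combination E1
  have h13a : IsCoprime 13 a := hXa.of_isCoprime_of_dvd_left h13
  obtain ⟨Y₁, hY₁⟩ : a ∣ Y := (hXa.symm.dvd_of_dvd_mul_left (h13a.symm.dvd_of_dvd_mul_left
    ⟨b₀ * S₁, by linear_combination -E2⟩))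
  have a0 : a ≠ 0 := by rintro rfl; exact Y0 (by rw [hY₁, zero_mul])
  have hSa : S = g ^ 2 * a + h * Y := by linear_combination hS + g * ha
  have hSb : S = h ^ 2 * b₀ + g * X := by linear_combination hS + h * hb₀
  have E3 : b₀ * S₁ = 13 * X * Y₁ := by
    apply mul_left_cancel₀ a0
    rw [hY₁] at E2
    linear_combination E2
  obtain ⟨S₂, hS₂⟩ : a ∣ S₁ := hka.symm.dvd_of_dvd_mul_left
    ⟨g ^ 2 + h * Y₁, by rw [← hS₁, hSa, hY₁]; ring⟩
  have hY₁b : IsCoprime Y₁ b₀ := hYb.of_isCoprime_of_dvd_left ⟨a, by rw [hY₁]; ring⟩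
  have hY₁g : IsCoprime Y₁ g := hYg.of_isCoprime_of_dvd_left ⟨a, by rw [hY₁]; ring⟩
  -- a and Y / a divide each other, so Y = ±a²; b and s below play the same game for X.
  have haY₁ : a ∣ Y₁ := hXa.symm.dvd_of_dvd_mul_left (h13a.symm.dvd_of_dvd_mul_left
    ⟨b₀ * S₂, by rw [hS₂] at E3; linear_combination -E3⟩)
  have hY₁a : Y₁ ∣ a := by
    have h1 : Y₁ ∣ S₁ := hY₁b.dvd_of_dvd_mul_left ⟨13 * X, by rw [E3]; ring⟩
    have h2 : Y₁ ∣ g ^ 2 * a := by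
      rw [show g ^ 2 * a = k * S₁ - Y₁ * (a * h) by rw [← hS₁, hSa, hY₁]; ring]
      exact dvd_sub (h1.mul_left k) (dvd_mul_right _ _)
    exact (hY₁g.pow_right).dvd_of_dvd_mul_left h2
  obtain ⟨e, he, heY⟩ : ∃ e : ℤ, (e = 1 ∨ e = -1) ∧ Y₁ = e * a := by
    rcases Int.associated_iff.1 (associated_of_dvd_dvd hY₁a haY₁) with h1 | h1
    · exact ⟨1, Or.inl rfl, by rw [h1, one_mul]⟩
    · exact ⟨-1, Or.inr rfl, by rw [h1]; ring⟩
  have he2 : e * e = 1 := by rcases he with rfl | rfl <;> norm_num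
  have E4 : b₀ * S₂ = 13 * X * e := by
    apply mul_left_cancel₀ a0
    rw [hS₂, heY] at E3
    linear_combination E3
  have n13h : ¬ 13 ∣ h := fun hd => p13.not_isUnit (hXh.isUnit_of_dvd' h13 hd)
  have n13k : ¬ 13 ∣ k := fun hd => p13.not_isUnit (hXk.isUnit_of_dvd' h13 hd)
  have n13a : ¬ 13 ∣ a := fun hd => p13.not_isUnit (hXa.isUnit_of_dvd' h13 hd)
  have hb13 : 13 ∣ b₀ := by
    by_contra hn
    have h1 : 13 ∣ S₂ := (p13.dvd_or_dvd ⟨X * e, by rw [E4]; ring⟩).resolve_left hn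
    have h2 : 13 ∣ h ^ 2 * b₀ := by
      rw [show h ^ 2 * b₀ = k * a * S₂ - g * X by
        linear_combination -hSb + hS₁ + k * hS₂]
      exact dvd_sub (h1.mul_left _) (h13.mul_left _)
    exact (p13.dvd_or_dvd h2).elim (fun h3 => n13h (p13.dvd_of_dvd_pow h3)) hn
  obtain ⟨b, hb⟩ := hb13
  obtain ⟨s, hs⟩ : 13 ∣ S₂ := by
    have h1 : 13 ∣ k * a * S₂ := by
      rw [show k * a * S₂ = h ^ 2 * b₀ + g * X by
        linear_combination hSb - hS₁ - k * hS₂, hb]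
      exact dvd_add ((dvd_mul_right _ _).mul_left _) (h13.mul_left _)
    exact ((p13.dvd_or_dvd h1).resolve_left fun h2 => (p13.dvd_or_dvd h2).elim n13k n13a)
  have hXs : X = e * (13 * (b * s)) := by
    have : b * s * 13 = X * e := by
      apply mul_left_cancel₀ p13.ne_zero
      rw [hb, hs] at E4
      linear_combination E4
    linear_combination -X * he2 - e * this
  have b0 : b ≠ 0 := by rintro rfl; exact X0 (by rw [hXs]; ring)
  have E5 : k * a * s = h ^ 2 * b + g * (e * (b * s)) := by
    apply mul_left_cancel₀ p13.ne_zero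
    linear_combination -hS₁ - k * hS₂ - k * a * hs + hSb + h ^ 2 * hb + g * hXs
  have hsb : s ∣ b := by
    have h1 : IsCoprime s h := hXh.of_isCoprime_of_dvd_left ⟨e * 13 * b, by rw [hXs]; ring⟩
    exact (h1.pow_right (n := 2)).dvd_of_dvd_mul_left
      ⟨k * a - g * e * b, by linear_combination -E5⟩
  have hbs : b ∣ s := by
    have h1 : IsCoprime b k := hXk.of_isCoprime_of_dvd_left ⟨e * 13 * s, by rw [hXs]; ring⟩
    have h2 : IsCoprime b a := hXa.of_isCoprime_of_dvd_left ⟨e * 13 * s, by rw [hXs]; ring⟩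
    exact (h1.mul_right h2).dvd_of_dvd_mul_left
      ⟨h ^ 2 + g * e * s, by linear_combination E5⟩
  obtain ⟨e', he', hes⟩ : ∃ e' : ℤ, (e' = 1 ∨ e' = -1) ∧ s = e * e' * b := by
    have h1 : s = b ∨ s = -b := Int.associated_iff.1 (associated_of_dvd_dvd hsb hbs)
    rcases he with rfl | rfl <;> rcases h1 with h1 | h1 <;> rw [h1]
    · exact ⟨1, Or.inl rfl, by ring⟩
    · exact ⟨-1, Or.inr rfl, by ring⟩
    · exact ⟨-1, Or.inr rfl, by ring⟩
    · exact ⟨1, Or.inl rfl, by ring⟩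
  refine ⟨a, b, e, e', he, he', ?_, ?_, ha, by rw [hb₀, hb], ?_, ?_⟩
  · rw [hXs, hes]
    linear_combination e' * 13 * b ^ 2 * he2
  · rw [hY₁, heY]
    ring
  · apply mul_left_cancel₀ b0
    rw [hes] at E5
    linear_combination -E5 - g * e' * b ^ 2 * he2
  · apply mul_left_cancel₀ a0
    rw [hes] at hs
    linear_combination -hSa + hS₁ + k * hS₂ + k * a * hs - h * hY₁ - h * a * heY

/-- A cycle of the Lyness map with invariant `13` comes from a point of the covering, whose
coordinates divide every common denominator of the cycle. -/
theorem exists_covering_of_dvd_num {x₀ x₁ x₂ x₃ x₄ : ℚ} (h₀ : x₀ * x₂ = 1 + x₁)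
    (h₁ : x₁ * x₃ = 1 + x₂) (h₂ : x₂ * x₄ = 1 + x₃) (h₃ : x₃ * x₀ = 1 + x₄)
    (h₄ : x₄ * x₁ = 1 + x₀) (hP : x₀ * x₁ * x₂ * x₃ * x₄ = 13) (h13 : 13 ∣ x₀.num) {m : ℤ}
    {y₁ y₂ y₃ y₄ : ℤ} (hy₁ : (y₁ : ℚ) = m * x₁) (hy₂ : (y₂ : ℚ) = m * x₂)
    (hy₃ : (y₃ : ℚ) = m * x₃) (hy₄ : (y₄ : ℚ) = m * x₄) :
    ∃ a : Fin 5 → ℤ, Covering a ∧ IsCoprime (a 1) (a 2) ∧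
      a 0 * (a 1 * a 2 * a 3 * a 4) ∣ m ∧ a 0 * (a 1 * a 2 * a 3 * a 4) ≠ 0 := by
  have hne : x₀ * x₁ * x₂ * x₃ * x₄ ≠ 0 := by rw [hP]; norm_num
  simp only [mul_ne_zero_iff] at hne
  obtain ⟨⟨⟨⟨n₀, n₁⟩, n₂⟩, n₃⟩, n₄⟩ := hne
  have E : (x₀ + 1) * (x₁ + 1) * (x₀ + x₁ + 1) = 13 * x₀ * x₁ := by
    have e1 : x₀ + x₁ + 1 = x₀ * x₁ * x₃ := by linear_combination -h₄ - x₁ * h₃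
    rw [e1, ← hP]
    linear_combination -x₀ * x₁ * x₃ * (x₁ + 1) * h₄ - x₀ * x₁ ^ 2 * x₃ * x₄ * h₀
  obtain ⟨p, q, p0, q0, hp, hq⟩ : ∃ p q : ℤ, p ≠ 0 ∧ q ≠ 0 ∧ p = x₀.den ∧ q = x₁.den :=
    ⟨x₀.den, x₁.den, by simp, by simp, rfl, rfl⟩
  have hcp : IsCoprime x₀.num p := by
    rw [hp, Int.isCoprime_iff_gcd_eq_one]; exact x₀.reduced
  have hcq : IsCoprime x₁.num q := by
    rw [hq, Int.isCoprime_iff_gcd_eq_one]; exact x₁.reduced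
  have hx₀ : x₀ * p = x₀.num := by rw [hp]; exact_mod_cast Rat.mul_den_eq_num x₀
  have hx₁ : x₁ * q = x₁.num := by rw [hq]; exact_mod_cast Rat.mul_den_eq_num x₁
  obtain ⟨k, h, g, k0, hgh, hpk, hqk⟩ := Int.exists_gcd_one' (m := p) (n := q)
    (Int.gcd_pos_of_ne_zero_left q p0)
  rw [← Int.isCoprime_iff_gcd_eq_one] at hgh
  generalize (k : ℤ) = k' at *
  rw [hpk] at hcp hx₀ p0
  rw [hqk] at hcq hx₁ q0
  push_cast at hx₀ hx₁
  have hX0 : x₀.num ≠ 0 := Rat.num_ne_zero.2 n₀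
  have hY0 : x₁.num ≠ 0 := Rat.num_ne_zero.2 n₁
  generalize x₀.num = X at *
  generalize x₁.num = Y at *
  obtain ⟨h0, k'0⟩ := mul_ne_zero_iff.1 p0
  obtain ⟨g0, -⟩ := mul_ne_zero_iff.1 q0
  obtain ⟨a, b, e, e', he, he', r1, r2, r3, r4, r5, r6⟩ :=
    exists_square_parametrization hcp hcq hgh.symm hX0 hY0 g0 h0 k'0 h13 (by
      have : (((X + h * k') * (Y + g * k') * (g * X + h * Y + g * h * k') : ℤ) : ℚ) =
          ((13 * X * Y * g * h * k' : ℤ) : ℚ) := by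
        push_cast
        rw [← hx₀, ← hx₁]
        linear_combination (h * k' * g * k' * (g * h * k') : ℚ) * E
      exact_mod_cast this)
  -- The signs e, e' are absorbed by taking (d₁, …, d₅) = (b, a, eh, ee'k, e'g). The recurrence then
  -- yields the same shape for x₂, x₃, x₄.
  obtain ⟨d1, d2, d3, d4, d5, q1, q2, q3, q4, c2, c1, c53, n1, n2, n3, n4, n5, f₀, f₁⟩ :
      ∃ d1 d2 d3 d4 d5 : ℤ, d2 * d5 = d3 * d4 + 13 * d1 ^ 2 ∧ 13 * d1 * d3 = d4 * d5 + d2 ^ 2 ∧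
        d2 * d4 = d5 * d1 + d3 ^ 2 ∧ 13 * d1 * d4 = d2 * d3 + d5 ^ 2 ∧ IsCoprime d2 (d5 * d4) ∧
        IsCoprime d1 (d3 * d4) ∧ IsCoprime d5 d3 ∧ d1 ≠ 0 ∧ d2 ≠ 0 ∧ d3 ≠ 0 ∧
        d4 ≠ 0 ∧ d5 ≠ 0 ∧ x₀ * (d3 * d4) = 13 * d1 ^ 2 ∧ x₁ * (d4 * d5) = d2 ^ 2 := by
    have ha0 : a ≠ 0 := by rintro rfl; exact hY0 (by rw [r2]; ring)
    have hb0 : b ≠ 0 := by rintro rfl; exact hX0 (by rw [r1]; ring)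
    have he0 : e ≠ 0 := by rintro rfl; simp at he
    have he'0 : e' ≠ 0 := by rintro rfl; simp at he'
    have ue : IsUnit e := Int.isUnit_iff.2 he
    have ue' : IsUnit e' := Int.isUnit_iff.2 he'
    have ee : e * e = 1 := by rcases he with rfl | rfl <;> norm_num
    have ee' : e' * e' = 1 := by rcases he' with rfl | rfl <;> norm_num
    have cb : IsCoprime b (h * k') :=
      hcp.of_isCoprime_of_dvd_left ⟨e' * 13 * b, by rw [r1]; ring⟩
    have ca : IsCoprime a (g * k') := hcq.of_isCoprime_of_dvd_left ⟨e * a, by rw [r2]; ring⟩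
    refine ⟨b, a, e * h, e * e' * k', e' * g, ?_, ?_, ?_, ?_, ?_, ?_, ?_, hb0, ha0,
      mul_ne_zero he0 h0, mul_ne_zero (mul_ne_zero he0 he'0) k'0, mul_ne_zero he'0 g0, ?_, ?_⟩
    · rw [r1] at r3
      linear_combination -e' * r3 - e' * h * k' * ee + 13 * b ^ 2 * ee'
    · rw [r2] at r4
      linear_combination -e * r4 + a ^ 2 * ee - e * g * k' * ee'
    · linear_combination -r5 - h ^ 2 * ee
    · linear_combination -r6 - g ^ 2 * ee'
    · rw [show e' * g * (e * e' * k') = e * (g * k') by linear_combination e * g * k' * ee']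
      exact (isCoprime_mul_unit_left_right ue _ _).2 ca
    · rw [show e * h * (e * e' * k') = e' * (h * k') by linear_combination e' * h * k' * ee]
      exact (isCoprime_mul_unit_left_right ue' _ _).2 cb
    · exact (isCoprime_mul_unit_left_left ue' _ _).2
        ((isCoprime_mul_unit_left_right ue _ _).2 hgh.symm)
    · have := congrArg (Int.cast : ℤ → ℚ) r1
      have ee := congrArg (Int.cast : ℤ → ℚ) ee
      have ee' := congrArg (Int.cast : ℤ → ℚ) ee'
      push_cast at this ee ee' ⊢
      linear_combination e' * hx₀ + e' * this + x₀ * e' * h * k' * ee + 13 * b ^ 2 * ee'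
    · have := congrArg (Int.cast : ℤ → ℚ) r2
      have ee := congrArg (Int.cast : ℤ → ℚ) ee
      have ee' := congrArg (Int.cast : ℤ → ℚ) ee'
      push_cast at this ee ee' ⊢
      linear_combination e * hx₁ + e * this + x₁ * e * g * k' * ee' + a ^ 2 * ee
  have q5 : d3 * d5 = d1 * d2 + d4 ^ 2 := by
    apply mul_left_cancel₀ (mul_ne_zero (by norm_num : (13 : ℤ) ≠ 0) n1)
    linear_combination d5 * q2 - d4 * q4 + d2 * q1
  have i1 : (d1 : ℚ) ≠ 0 := Int.cast_ne_zero.2 n1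
  have i2 : (d2 : ℚ) ≠ 0 := Int.cast_ne_zero.2 n2
  have i3 : (d3 : ℚ) ≠ 0 := Int.cast_ne_zero.2 n3
  have i4 : (d4 : ℚ) ≠ 0 := Int.cast_ne_zero.2 n4
  have i5 : (d5 : ℚ) ≠ 0 := Int.cast_ne_zero.2 n5
  have q2' := congrArg (Int.cast : ℤ → ℚ) q2
  have q3' := congrArg (Int.cast : ℤ → ℚ) q3
  have q5' := congrArg (Int.cast : ℤ → ℚ) q5
  push_cast at q2' q3' q5'
  have f₂ : x₂ * (d5 * d1) = d3 ^ 2 := by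
    apply mul_left_cancel₀ (mul_ne_zero (by norm_num : (13 : ℚ) ≠ 0) i1)
    linear_combination -x₂ * d5 * f₀ + d3 * d4 * d5 * h₀ + d3 * f₁ - d3 * q2'
  have f₃ : x₃ * (d1 * d2) = d4 ^ 2 := by
    apply mul_left_cancel₀ i2
    linear_combination -x₃ * d1 * f₁ + d4 * d5 * d1 * h₁ + d4 * f₂ - d4 * q3'
  have f₄ : x₄ * (d2 * d3) = d5 ^ 2 := by
    apply mul_left_cancel₀ i3
    linear_combination -x₄ * d2 * f₂ + d5 * d1 * d2 * h₂ + d5 * f₃ - d5 * q5'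
  have g₁ : y₁ * (d4 * d5) = m * d2 ^ 2 := by
    have : ((y₁ * (d4 * d5) : ℤ) : ℚ) = ((m * d2 ^ 2 : ℤ) : ℚ) := by
      push_cast; rw [hy₁, ← f₁]; ring
    exact_mod_cast this
  have g₂ : y₂ * (d5 * d1) = m * d3 ^ 2 := by
    have : ((y₂ * (d5 * d1) : ℤ) : ℚ) = ((m * d3 ^ 2 : ℤ) : ℚ) := by
      push_cast; rw [hy₂, ← f₂]; ring
    exact_mod_cast this
  have g₃ : y₃ * (d1 * d2) = m * d4 ^ 2 := by
    have : ((y₃ * (d1 * d2) : ℤ) : ℚ) = ((m * d4 ^ 2 : ℤ) : ℚ) := by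
      push_cast; rw [hy₃, ← f₃]; ring
    exact_mod_cast this
  have g₄ : y₄ * (d2 * d3) = m * d5 ^ 2 := by
    have : ((y₄ * (d2 * d3) : ℤ) : ℚ) = ((m * d5 ^ 2 : ℤ) : ℚ) := by
      push_cast; rw [hy₄, ← f₄]; ring
    exact_mod_cast this
  have c12 : IsCoprime d1 d2 := isCoprime_of_prime_dvd (fun h => n1 h.1) fun p hp hu hv =>
    hp.not_isUnit (c1.isUnit_of_dvd' hu (by
      rw [show d3 * d4 = d2 * d5 - d1 * (13 * d1) by linear_combination -q1]
      exact dvd_sub (hv.mul_right _) (hu.mul_right _)))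
  have c23 : IsCoprime d2 d3 := isCoprime_of_prime_dvd (fun h => n2 h.1) fun p hp hu hv =>
    hp.not_isUnit (c2.isUnit_of_dvd' hu (by
      rw [show d5 * d4 = d3 * (13 * d1) - d2 * d2 by linear_combination -q2]
      exact dvd_sub (hv.mul_right _) (hu.mul_right _)))
  have c15 : IsCoprime d1 d5 := isCoprime_of_prime_dvd (fun h => n1 h.1) fun p hp hu hv =>
    hp.not_isUnit (c2.isUnit_of_dvd' (hp.dvd_of_dvd_pow (n := 2) (by
      rw [show d2 ^ 2 = d1 * (13 * d3) - d5 * d4 by linear_combination -q2]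
      exact dvd_sub (hu.mul_right _) (hv.mul_right _))) (hv.mul_right _))
  have c45 : IsCoprime d4 d5 := isCoprime_of_prime_dvd (fun h => n4 h.1) fun p hp hu hv =>
    hp.not_isUnit (c53.isUnit_of_dvd' hv (hp.dvd_of_dvd_pow (n := 2) (by
      rw [show d3 ^ 2 = d4 * d2 - d5 * d1 by linear_combination -q3]
      exact dvd_sub (hu.mul_right _) (hv.mul_right _))))
  have c34 : IsCoprime d3 d4 := isCoprime_of_prime_dvd (fun h => n3 h.1) fun p hp hu hv =>
    (hp.dvd_or_dvd (show p ∣ d5 * d1 by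
      rw [show d5 * d1 = d4 * d2 - d3 * d3 by linear_combination -q3]
      exact dvd_sub (hv.mul_right _) (hu.mul_right _))).elim
      (fun h => hp.not_isUnit (c53.isUnit_of_dvd' h hu))
      (fun h => hp.not_isUnit (c1.isUnit_of_dvd' h (hu.mul_right _)))
  -- Each dⱼ occurs in the denominator of one of x₁, …, x₄ whose numerator is coprime to it, so it
  -- divides m. Pairwise coprimality passes this to the product.
  have m5 : d5 ∣ m := (c53.pow_right (n := 2)).dvd_of_dvd_mul_right
    ⟨y₂ * d1, by linear_combination -g₂⟩
  have m1 : d1 ∣ m := (c1.of_mul_right_left.pow_right (n := 2)).dvd_of_dvd_mul_right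
    ⟨y₂ * d5, by linear_combination -g₂⟩
  have m2 : d2 ∣ m := (c2.of_mul_right_right.pow_right (n := 2)).dvd_of_dvd_mul_right
    ⟨y₃ * d1, by linear_combination -g₃⟩
  have m3 : d3 ∣ m := (c53.symm.pow_right (n := 2)).dvd_of_dvd_mul_right
    ⟨y₄ * d2, by linear_combination -g₄⟩
  have m4 : d4 ∣ m := (c2.of_mul_right_right.symm.pow_right (n := 2)).dvd_of_dvd_mul_right
    ⟨y₁ * d5, by linear_combination -g₁⟩
  refine ⟨![d1, d4, d2, -d5, -d3], ⟨?_, ?_, ?_, ?_, ?_⟩, ?_, ?_, ?_⟩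
  · simp; linear_combination q1
  · simp; linear_combination -q2
  · simp; linear_combination -q3
  · simp; linear_combination -q5
  · simp; linear_combination -q4
  · simpa using c2.of_mul_right_right.symm
  · have d45 := c45.mul_dvd m4 m5
    have d345 := (c34.mul_right c53.symm).mul_dvd m3 d45
    have d2345 := (c23.mul_right (c2.of_mul_right_right.mul_right c2.of_mul_right_left)).mul_dvd
      m2 d345
    have := (c12.mul_right (c1.of_mul_right_left.mul_right
      (c1.of_mul_right_right.mul_right c15))).mul_dvd m1 d2345
    rw [show d1 * (d2 * (d3 * (d4 * d5))) = d1 * (d4 * d2 * -d5 * -d3) by ring] at this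
    simpa using this
  · simp; tauto

/-- The product of the cycle is 13, so 13 divides some numerator; the relations are cyclic, so this
term may be put first. -/
theorem exists_covering_of_cycle {x₀ x₁ x₂ x₃ x₄ : ℚ} (h₀ : x₀ * x₂ = 1 + x₁)
    (h₁ : x₁ * x₃ = 1 + x₂) (h₂ : x₂ * x₄ = 1 + x₃) (h₃ : x₃ * x₀ = 1 + x₄)
    (h₄ : x₄ * x₁ = 1 + x₀) (hP : x₀ * x₁ * x₂ * x₃ * x₄ = 13) {m y₀ y₁ y₂ y₃ y₄ : ℤ}
    (hy₀ : (y₀ : ℚ) = m * x₀) (hy₁ : (y₁ : ℚ) = m * x₁) (hy₂ : (y₂ : ℚ) = m * x₂)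
    (hy₃ : (y₃ : ℚ) = m * x₃) (hy₄ : (y₄ : ℚ) = m * x₄) :
    ∃ a : Fin 5 → ℤ, Covering a ∧ IsCoprime (a 1) (a 2) ∧
      a 0 * (a 1 * a 2 * a 3 * a 4) ∣ m ∧ a 0 * (a 1 * a 2 * a 3 * a 4) ≠ 0 := by
  have p13 : Prime (13 : ℤ) := by norm_num
  have hd : (13 : ℤ) ∣ x₀.num * x₁.num * x₂.num * x₃.num * x₄.num := by
    refine ⟨x₀.den * x₁.den * x₂.den * x₃.den * x₄.den, ?_⟩
    have : ((x₀.num * x₁.num * x₂.num * x₃.num * x₄.num : ℤ) : ℚ) =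
        ((13 * (x₀.den * x₁.den * x₂.den * x₃.den * x₄.den) : ℤ) : ℚ) := by
      push_cast
      rw [← Rat.mul_den_eq_num x₀, ← Rat.mul_den_eq_num x₁, ← Rat.mul_den_eq_num x₂,
        ← Rat.mul_den_eq_num x₃, ← Rat.mul_den_eq_num x₄, ← hP]
      ring
    exact_mod_cast this
  rcases p13.dvd_or_dvd hd with hd | hd
  · rcases p13.dvd_or_dvd hd with hd | hd
    · rcases p13.dvd_or_dvd hd with hd | hd
      · rcases p13.dvd_or_dvd hd with hd | hd
        · exact exists_covering_of_dvd_num h₀ h₁ h₂ h₃ h₄ hP hd hy₁ hy₂ hy₃ hy₄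
        · exact exists_covering_of_dvd_num h₁ h₂ h₃ h₄ h₀ (by rw [← hP]; ring) hd hy₂ hy₃ hy₄ hy₀
      · exact exists_covering_of_dvd_num h₂ h₃ h₄ h₀ h₁ (by rw [← hP]; ring) hd hy₃ hy₄ hy₀ hy₁
    · exact exists_covering_of_dvd_num h₃ h₄ h₀ h₁ h₂ (by rw [← hP]; ring) hd hy₄ hy₀ hy₁ hy₂
  · exact exists_covering_of_dvd_num h₄ h₀ h₁ h₂ h₃ (by rw [← hP]; ring) hd hy₀ hy₁ hy₂ hy₃

/-! ### Infinite descent. -/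

theorem Covering.exists_dvd {a : Fin 5 → ℤ} (h : Covering a) (hc : IsCoprime (a 1) (a 2))
    (ha0 : a 0 ≠ 0) : ∃ a' : Fin 5 → ℤ, Covering a' ∧ IsCoprime (a' 1) (a' 2) ∧
      a' 0 * (a' 1 * a' 2 * a' 3 * a' 4) ∣ a 0 ∧ a' 0 * (a' 1 * a' 2 * a' 3 * a' 4) ≠ 0 := by
  obtain ⟨R, _, _, _, z, s, hz⟩ := exists_cyclotomicFive
  obtain ⟨m, t, hm, ht⟩ := h.exists_fifth_powers hz hc ha0
  obtain ⟨y, hm0, hma, hy, hy5, hsum⟩ := h.exists_recurrence hz ha0 hm ht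
  have m0 : (m : ℚ) ≠ 0 := Int.cast_ne_zero.2 hm0
  have key : ∀ n, (y n / m : ℚ) * (y (n + 2) / m) = 1 + y (n + 1) / m := fun n => by
    have := congrArg (Int.cast : ℤ → ℚ) (hy n)
    push_cast at this
    field_simp
    linear_combination this
  have k0 := key 0
  have k1 := key 1
  have k2 := key 2
  have k3 := key 3
  have k4 := key 4
  have e5 : y 5 = y 0 := hy5 0
  have e6 : y 6 = y 1 := hy5 1
  norm_num only at k0 k1 k2 k3 k4
  rw [e5] at k3 k4
  rw [e6] at k4
  have hs : (y 0 / m + y 1 / m + y 2 / m + y 3 / m + y 4 / m : ℚ) = 10 := by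
    have := congrArg (Int.cast : ℤ → ℚ) hsum
    push_cast at this
    field_simp
    linear_combination this
  have hmul : ∀ n, (y n : ℚ) = m * (y n / m) := fun n => by field_simp
  -- In a Lyness cycle the product equals the sum plus 3, so the sum 10 means invariant 13.
  obtain ⟨a', h', hc', hd, hne⟩ := exists_covering_of_cycle k0 k1 k2 k3 k4 (by
    linear_combination hs + (y 1 / m * (y 3 / m) * (y 4 / m) : ℚ) * k0 +
      (1 + y 1 / m : ℚ) * (y 4 / m) * k1 + k4 + k2 + (y 2 / m : ℚ) * k4 + k0) (hmul 0) (hmul 1)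
          (hmul 2)
      (hmul 3) (hmul 4)
  exact ⟨a', h', hc', hd.trans hma, hne⟩

theorem Covering.eq_zero {a : Fin 5 → ℤ} (h : Covering a) (hc : IsCoprime (a 1) (a 2)) :
    a 0 = 0 := by
  by_contra ha0
  induction hn : (a 0).natAbs using Nat.strong_induction_on generalizing a with
  | _ n ih =>
    obtain ⟨a', h', hc', hd, hne⟩ := h.exists_dvd hc ha0
    obtain ⟨n0, n1⟩ := mul_ne_zero_iff.1 hne
    have hle := Int.natAbs_le_of_dvd_ne_zero hd ha0
    rw [Int.natAbs_mul] at hle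
    have hlt : ¬ (a' 0).natAbs < n := fun hlt => ih _ hlt h' hc' n0 rfl
    -- If |a'₀| does not drop, the other coordinates are ±1, and `e4` makes 13a'₀ one of 0, ±2,
    -- which is impossible for a'₀ ≠ 0.
    have hu : (a' 1 * a' 2 * a' 3 * a' 4).natAbs = 1 := by
      have := Int.natAbs_pos.2 n1
      have := Int.natAbs_pos.2 n0
      nlinarith
    have hu' := Int.isUnit_iff_natAbs_eq.2 hu
    simp only [IsUnit.mul_iff, Int.isUnit_iff] at hu'
    obtain ⟨⟨⟨u1, u2⟩, u3⟩, u4⟩ := hu'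
    have e := h'.e4
    rcases u1 with u1 | u1 <;> rcases u2 with u2 | u2 <;> rcases u3 with u3 | u3 <;>
      rcases u4 with u4 | u4 <;> rw [u1, u2, u3, u4] at e <;> omega

/-- The affine curve has no rational points besides the ones on the coordinate axes. -/
theorem eq_zero_of_curve {x y : ℚ} (h : (x + 1) * (y + 1) * (x + y + 1) = 13 * x * y) :
    x * y = 0 := by
  by_contra hxy
  obtain ⟨x0, y0⟩ := mul_ne_zero_iff.1 hxy
  obtain ⟨⟨m, _⟩, hm⟩ := IsLocalization.exist_integer_multiples_of_finset (nonZeroDivisors ℤ)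
    {x, y, (1 + y) / x, (1 + x + y) / (x * y), (1 + x) / y}
  simp only [Finset.mem_insert, Finset.mem_singleton, forall_eq_or_imp, forall_eq,
    IsLocalization.IsInteger, zsmul_eq_mul, RingHom.mem_rangeS,
    algebraMap_int_eq, eq_intCast] at hm
  obtain ⟨⟨n0, h0⟩, ⟨n1, h1⟩, ⟨n2, h2⟩, ⟨n3, h3⟩, n4, h4⟩ := hm
  obtain ⟨a, h, hc, -, hne⟩ := exists_covering_of_cycle (x₀ := x) (x₁ := y) (by field_simp)
    (by field_simp; ring) (by field_simp; ring) (by field_simp; ring) (by field_simp)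
    (by field_simp; linear_combination h) h0 h1 h2 h3 h4
  exact (mul_ne_zero_iff.1 hne).1 (h.eq_zero hc)

/-! ### The five rational points and the lines through them. -/

theorem LineMeets.swap {h : ℚ} {P Q R : E h} (H : LineMeets h P Q R) : LineMeets h Q P R := by
  obtain ⟨u, v, huv, a, b, c, ha, hb, hc, hP, hQ, hR, k, hk, hF⟩ := H
  exact ⟨u, v, huv, b, a, c, hb, ha, hc, hQ, hP, hR, k, hk, fun s t => by rw [hF]; ring⟩

theorem LineMeets.rotate {h : ℚ} {P Q R : E h} (H : LineMeets h P Q R) : LineMeets h Q R P := by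
  obtain ⟨u, v, huv, a, b, c, ha, hb, hc, hP, hQ, hR, k, hk, hF⟩ := H
  exact ⟨u, v, huv, b, c, a, hb, hc, ha, hQ, hR, hP, k, hk, fun s t => by rw [hF]; ring⟩

/-- Homogeneous coordinates of the five rational points of `E 13`; the index is the place in the
cyclic group. -/
def coord : ZMod 5 → Fin 3 → ℤ :=
  (![![1, -1, 0], ![0, 1, 0], ![0, -1, 1], ![-1, 0, 1], ![1, 0, 0]] : Fin 5 → Fin 3 → ℤ)

theorem coord_zero : coord 0 = ![1, -1, 0] := rfl
theorem coord_one : coord 1 = ![0, 1, 0] := rfl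
theorem coord_two : coord 2 = ![0, -1, 1] := rfl
theorem coord_three : coord 3 = ![-1, 0, 1] := rfl
theorem coord_four : coord 4 = ![1, 0, 0] := rfl

/-- The derivative of `cubic 13` at `p` in the direction `d`. -/
def polar {R : Type*} [CommRing R] (p d : Fin 3 → R) : R :=
  (d 0 + d 2) * (p 1 + p 2) * (p 0 + p 1 + p 2) + (p 0 + p 2) * (d 1 + d 2) * (p 0 + p 1 + p 2) +
    (p 0 + p 2) * (p 1 + p 2) * (d 0 + d 1 + d 2) -
    13 * (d 0 * p 1 * p 2 + p 0 * d 1 * p 2 + p 0 * p 1 * d 2)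

/-- The determinant of three vectors. -/
def triple {R : Type*} [CommRing R] (p q r : Fin 3 → R) : R :=
  p 0 * (q 1 * r 2 - q 2 * r 1) - p 1 * (q 0 * r 2 - q 2 * r 0) + p 2 * (q 0 * r 1 - q 1 * r 0)

/-- Intersection multiplicities are encoded by finitely checkable conditions: collinearity, tangency
at a repeated point, and, for a triple point, a tangent that misses the other four points. -/
theorem add_eq_zero_of_coord : ∀ i j k : ZMod 5, triple (coord i) (coord j) (coord k) = 0 →
    (i = j → polar (coord i) (coord k) = 0) → (j = k → polar (coord j) (coord i) = 0) →
    (k = i → polar (coord k) (coord j) = 0) →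
    (i = j → j = k → ∀ l, polar (coord i) (coord l) = 0 → l = i) → i + j + k = 0 := by
  unfold triple polar
  decide

/-- The point of `E 13` with the coordinates `coord i`. -/
def pt (i : ZMod 5) : E 13 :=
  ⟨Projectivization.mk ℚ (fun j => (coord i j : ℚ)) (by
    have h : ∀ i : ZMod 5, ∃ j, coord i j ≠ 0 := by decide
    obtain ⟨j, hj⟩ := h i
    exact fun h0 => hj (by simpa using congrFun h0 j)), by
    intro p hp
    rw [Projectivization.submodule_mk, Submodule.mem_span_singleton] at hp
    obtain ⟨c, rfl⟩ := hp
    rw [cubic_smul]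
    have h : ∀ i : ZMod 5, (coord i 0 + coord i 2) * (coord i 1 + coord i 2) *
        (coord i 0 + coord i 1 + coord i 2) - 13 * coord i 0 * coord i 1 * coord i 2 = 0 := by
      decide
    have := congrArg (Int.cast : ℤ → ℚ) (h i)
    push_cast at this
    rw [cubic, this, mul_zero]⟩

theorem mem_pt {i : ZMod 5} {p : Fin 3 → ℚ} :
    p ∈ (pt i).1.submodule ↔ ∃ c : ℚ, (fun j => c * coord i j) = p := by
  rw [pt, Projectivization.submodule_mk, Submodule.mem_span_singleton]
  rfl

theorem eq_of_coord_mul_eq {i j : ZMod 5}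
    (h : ∀ l l', coord i l * coord j l' = coord i l' * coord j l) : i = j := by
  have key : ∀ i j : ZMod 5, coord i 0 * coord j 1 = coord i 1 * coord j 0 →
      coord i 0 * coord j 2 = coord i 2 * coord j 0 →
      coord i 1 * coord j 2 = coord i 2 * coord j 1 → i = j := by decide
  exact key i j (h _ _) (h _ _) (h _ _)

theorem pt_injective : Function.Injective pt := by
  intro i j hij
  have h1 : (fun l => (coord i l : ℚ)) ∈ (pt j).1.submodule := by
    rw [← hij, mem_pt]
    exact ⟨1, by simp⟩
  obtain ⟨c, hc⟩ := mem_pt.1 h1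
  refine eq_of_coord_mul_eq fun l l' => ?_
  have e1 := congrFun hc l
  have e2 := congrFun hc l'
  have : ((coord i l * coord j l' : ℤ) : ℚ) = ((coord i l' * coord j l : ℤ) : ℚ) := by
    push_cast
    rw [← e1, ← e2]
    ring
  exact_mod_cast this

theorem pt_surjective : Function.Surjective pt := by
  rintro ⟨P, hP⟩
  induction P using Projectivization.ind with
  | h p p0 =>
    suffices h : ∃ (i : ZMod 5) (c : ℚ), p = fun j => c * coord i j by
      obtain ⟨i, c, hc⟩ := h
      refine ⟨i, Subtype.ext (((Projectivization.mk_eq_mk_iff' ℚ _ _ _ _).2 ⟨c, ?_⟩).symm)⟩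
      rw [hc]
      rfl
    have hF : cubic 13 p = 0 := hP p (by
      rw [Projectivization.submodule_mk]
      exact Submodule.mem_span_singleton_self p)
    have ext3 : ∀ (i : ZMod 5) (c : ℚ), p 0 = c * coord i 0 → p 1 = c * coord i 1 →
        p 2 = c * coord i 2 → ∃ (i : ZMod 5) (c : ℚ), p = fun j => c * coord i j :=
      fun i c h0 h1 h2 => ⟨i, c, by funext j; fin_cases j <;> assumption⟩
    rw [cubic] at hF
    by_cases h2 : p 2 = 0
    · have : p 0 * (p 1 * (p 0 + p 1)) = 0 := by
        rw [h2] at hF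
        linear_combination hF
      rcases mul_eq_zero.1 this with h0 | h
      · exact ext3 1 (p 1) (by simp [coord_one, h0]) (by simp [coord_one]) (by simp [coord_one, h2])
      rcases mul_eq_zero.1 h with h1 | h
      · exact ext3 4 (p 0) (by simp [coord_four]) (by simp [coord_four, h1]) (by simp [coord_four,
          h2])
      · exact ext3 0 (p 0) (by simp [coord_zero]) (by simp [coord_zero]; linarith) (by simp
          [coord_zero, h2])
    · have hxy : p 0 / p 2 * (p 1 / p 2) = 0 := eq_zero_of_curve (by
        field_simp
        linear_combination hF)
      have h01 : p 0 * p 1 = 0 := by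
        field_simp at hxy
        linear_combination hxy
      rcases mul_eq_zero.1 h01 with h0 | h1
      · have : (p 1 + p 2) ^ 2 = 0 := by
          apply mul_left_cancel₀ h2
          rw [h0] at hF
          linear_combination hF
        have h1 := pow_eq_zero_iff (two_ne_zero) |>.1 this
        exact ext3 2 (p 2) (by simp [coord_two, h0]) (by simp [coord_two]; linarith) (by simp
            [coord_two])
      · have : (p 0 + p 2) ^ 2 = 0 := by
          apply mul_left_cancel₀ h2
          rw [h1] at hF
          linear_combination hF
        have h0 := pow_eq_zero_iff (two_ne_zero) |>.1 this
        exact ext3 3 (p 2) (by simp [coord_three]; linarith) (by simp [coord_three, h1]) (by simp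
            [coord_three])

section line

variable {u v : Fin 3 → ℚ} {a b c : Fin 2 → ℚ} {k : ℚ}

theorem polar_eq_zero (hF : ∀ s t : ℚ, cubic 13 (s • u + t • v) =
      k * (s * a 1 - t * a 0) * (s * b 1 - t * b 0) * (s * c 1 - t * c 0))
    (hab : a 0 * b 1 = a 1 * b 0) (s t : ℚ) :
    polar (a 0 • u + a 1 • v) (s • u + t • v) = 0 := by
  -- For a cubic polynomial g, g'(0) = g(1) - g(-1)/3 - g(2)/6 - g(0)/2; here g is the restriction
  -- along the line through a double root, where the derivative vanishes.
  have e0 := hF (a 0) (a 1)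
  have e1 := hF (a 0 + s) (a 1 + t)
  have e2 := hF (a 0 - s) (a 1 - t)
  have e3 := hF (a 0 + 2 * s) (a 1 + 2 * t)
  simp only [cubic, polar, Pi.add_apply, Pi.smul_apply, smul_eq_mul] at *
  linear_combination e1 - 1 / 3 * e2 - 1 / 6 * e3 - 1 / 2 * e0 +
    k * (s * a 1 - t * a 0) * (a 0 * c 1 - a 1 * c 0) * hab

theorem ne_zero_of_smul_add (huv : LinearIndependent ℚ ![u, v]) (ha : a ≠ 0) :
    a 0 • u + a 1 • v ≠ 0 := fun h0 => by
  obtain ⟨h1, h2⟩ := LinearIndependent.pair_iff.1 huv _ _ h0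
  exact ha (by funext j; fin_cases j <;> assumption)

theorem exists_coord_eq {i : ZMod 5} (huv : LinearIndependent ℚ ![u, v]) (ha : a ≠ 0)
    (hi : a 0 • u + a 1 • v ∈ (pt i).1.submodule) :
    ∃ s : ℚ, s ≠ 0 ∧ (fun j => (coord i j : ℚ)) = (s * a 0) • u + (s * a 1) • v := by
  obtain ⟨s, hs⟩ := mem_pt.1 hi
  have s0 : s ≠ 0 := by
    rintro rfl
    exact ne_zero_of_smul_add huv ha (by rw [← hs]; funext j; simp)
  refine ⟨s⁻¹, inv_ne_zero s0, ?_⟩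
  rw [← smul_smul, ← smul_smul, ← smul_add, ← hs]
  funext j
  simp [s0]

theorem mul_eq_mul_of_coord_eq {w : Fin 3 → ℚ} (huv : LinearIndependent ℚ ![u, v]) {s t : ℚ}
    (hs : s ≠ 0) (ht : t ≠ 0) (ha : w = (s * a 0) • u + (s * a 1) • v)
    (hb : w = (t * b 0) • u + (t * b 1) • v) : a 0 * b 1 = a 1 * b 0 := by
  obtain ⟨h1, h2⟩ := LinearIndependent.pair_iff.1 huv (s * a 0 - t * b 0) (s * a 1 - t * b 1) (by
    rw [sub_smul, sub_smul]
    linear_combination (exp := 1) hb - ha)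
  apply mul_left_cancel₀ (mul_ne_zero hs ht)
  linear_combination t * b 1 * h1 - t * b 0 * h2

end line

theorem polar_smul_left (s : ℚ) (p d : Fin 3 → ℚ) : polar (s • p) d = s ^ 2 * polar p d := by
  simp only [polar, Pi.smul_apply, smul_eq_mul]
  ring

theorem polar_intCast (p d : Fin 3 → ℤ) :
    polar (fun j => (p j : ℚ)) (fun j => (d j : ℚ)) = (polar p d : ℤ) := by
  simp [polar]

theorem polar_eq_sum (p d : Fin 3 → ℚ) :
    polar p d = ∑ j, d j * polar p (Pi.single j 1) := by
  simp [Fin.sum_univ_three, polar]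
  ring

theorem polar_coord_eq_zero {i j k : ZMod 5} (H : LineMeets 13 (pt i) (pt j) (pt k))
    (hij : i = j) : polar (coord i) (coord k) = 0 := by
  obtain ⟨u, v, huv, a, b, c, ha, hb, hc, hP, hQ, hR, K, hK, hF⟩ := H
  obtain ⟨s, s0, hs⟩ := exists_coord_eq huv ha hP
  obtain ⟨t, t0, ht⟩ := exists_coord_eq huv hb hQ
  obtain ⟨r, r0, hr⟩ := exists_coord_eq huv hc hR
  subst hij
  have hab := mul_eq_mul_of_coord_eq huv s0 t0 hs ht
  have := polar_eq_zero hF hab (r * c 0) (r * c 1)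
  rw [← hr] at this
  have h2 : ((polar (coord i) (coord k) : ℤ) : ℚ) = 0 := by
    rw [← polar_intCast, hs, mul_smul, mul_smul, ← smul_add, polar_smul_left, this, mul_zero]
  exact_mod_cast h2

theorem triple_coord_eq_zero {i j k : ZMod 5} (H : LineMeets 13 (pt i) (pt j) (pt k)) :
    triple (coord i) (coord j) (coord k) = 0 := by
  obtain ⟨u, v, huv, a, b, c, ha, hb, hc, hP, hQ, hR, K, hK, hF⟩ := H
  obtain ⟨s, s0, hs⟩ := exists_coord_eq huv ha hP
  obtain ⟨t, t0, ht⟩ := exists_coord_eq huv hb hQ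
  obtain ⟨r, r0, hr⟩ := exists_coord_eq huv hc hR
  have h2 : triple (fun l => (coord i l : ℚ)) (fun l => (coord j l : ℚ))
      (fun l => (coord k l : ℚ)) = 0 := by
    rw [hs, ht, hr]
    simp only [triple, Pi.add_apply, Pi.smul_apply, smul_eq_mul]
    ring
  have h3 : ((triple (coord i) (coord j) (coord k) : ℤ) : ℚ) = 0 := by
    rw [← h2]
    simp only [triple]
    push_cast
    ring
  exact_mod_cast h3

/-- The gradient at the point is nonzero, so the tangent is the line spanned by u and v. On it the
cubic is a multiple of a cube, with only one root. -/
theorem eq_of_polar_coord_eq_zero {i l : ZMod 5} (H : LineMeets 13 (pt i) (pt i) (pt i))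
    (hl : polar (coord i) (coord l) = 0) : l = i := by
  obtain ⟨u, v, huv, a, b, c, ha, hb, hc, hP, hQ, hR, K, hK, hF⟩ := H
  obtain ⟨s, s0, hs⟩ := exists_coord_eq huv ha hP
  obtain ⟨t, t0, ht⟩ := exists_coord_eq huv hb hQ
  obtain ⟨r, r0, hr⟩ := exists_coord_eq huv hc hR
  have hab := mul_eq_mul_of_coord_eq huv s0 t0 hs ht
  have hac := mul_eq_mul_of_coord_eq huv s0 r0 hs hr
  obtain ⟨p, q, hpq⟩ : ∃ p q : ℚ, (fun j => (coord l j : ℚ)) = p • u + q • v := by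
    have hpol : ∀ s t : ℚ, polar (fun j => (coord i j : ℚ)) (s • u + t • v) = 0 := fun x y => by
      rw [hs, mul_smul, mul_smul, ← smul_add, polar_smul_left, polar_eq_zero hF hab, mul_zero]
    have hu := hpol 1 0
    have hv := hpol 0 1
    have hw := congrArg (Int.cast : ℤ → ℚ) hl
    rw [← polar_intCast, Int.cast_zero] at hw
    simp only [one_smul, zero_smul, add_zero, zero_add] at hu hv
    rw [polar_eq_sum] at hu hv hw
    have hG : (fun j => polar (fun j => (coord i j : ℚ)) (Pi.single j 1)) ≠ 0 := by
      have : ∀ i : ZMod 5, ∃ j, polar (coord i) (Pi.single j 1) ≠ 0 := by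
        unfold polar
        decide
      obtain ⟨j, hj⟩ := this i
      intro h0
      apply hj
      have := congrFun h0 j
      have e : (Pi.single j 1 : Fin 3 → ℚ) = fun l => ((Pi.single j 1 : Fin 3 → ℤ) l : ℚ) := by
        funext l
        simp [Pi.single_apply]
      rw [e, polar_intCast] at this
      simpa using this
    -- Three vectors annihilated by the nonzero gradient are linearly dependent.
    obtain ⟨x, hx0, hx⟩ := Matrix.exists_vecMul_eq_zero_iff.2 (Matrix.exists_mulVec_eq_zero_iff.1
      ⟨_, hG, show (Matrix.of ![u, v, fun j => (coord l j : ℚ)]).mulVec _ = 0 by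
        funext j
        fin_cases j
        · exact hu
        · exact hv
        · exact hw⟩)
    have hx' : x 0 • u + x 1 • v + x 2 • (fun j => (coord l j : ℚ)) = 0 := by
      funext j
      have := congrFun hx j
      simpa [Matrix.vecMul, dotProduct, Fin.sum_univ_three] using this
    have hx2 : x 2 ≠ 0 := fun h2 => by
      rw [h2, zero_smul, add_zero] at hx'
      obtain ⟨h0, h1⟩ := LinearIndependent.pair_iff.1 huv _ _ hx'
      exact hx0 (by funext j; fin_cases j <;> assumption)
    refine ⟨-(x 0 / x 2), -(x 1 / x 2), ?_⟩
    funext j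
    have := congrFun hx' j
    simp only [Pi.add_apply, Pi.smul_apply, smul_eq_mul, Pi.zero_apply] at this ⊢
    field_simp
    linear_combination this
  have hF' := hF p q
  have hl0 : cubic 13 (p • u + q • v) = 0 := by
    rw [← hpq]
    exact (pt l).2 _ (mem_pt.2 ⟨1, by simp⟩)
  rw [hl0] at hF'
  have key : ∀ b : Fin 2 → ℚ, b ≠ 0 → a 0 * b 1 = a 1 * b 0 → p * b 1 - q * b 0 = 0 →
      p * a 1 - q * a 0 = 0 := fun b hb hab h => by
    by_contra hne
    refine hb ?_
    funext j
    fin_cases j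
    · refine (mul_eq_zero.1 ?_).resolve_left hne
      change (p * a 1 - q * a 0) * b 0 = 0
      linear_combination a 0 * h - p * hab
    · refine (mul_eq_zero.1 ?_).resolve_left hne
      change (p * a 1 - q * a 0) * b 1 = 0
      linear_combination a 1 * h - q * hab
  have hpa : p * a 1 - q * a 0 = 0 := by
    rcases mul_eq_zero.1 hF'.symm with h | h
    · rcases mul_eq_zero.1 h with h | h
      · exact (mul_eq_zero.1 h).resolve_left hK
      · exact key b hb hab h
    · exact key c hc hac h
  refine eq_of_coord_mul_eq fun m m' => ?_
  have e1 := congrFun hpq m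
  have e2 := congrFun hpq m'
  have e3 := congrFun hs m
  have e4 := congrFun hs m'
  have : ((coord l m * coord i m' : ℤ) : ℚ) = ((coord l m' * coord i m : ℤ) : ℚ) := by
    push_cast
    simp only [Pi.add_apply, Pi.smul_apply, smul_eq_mul] at e1 e2 e3 e4
    rw [e1, e2, e3, e4]
    linear_combination s * (u m * v m' - u m' * v m) * hpa
  exact_mod_cast this

theorem add_eq_zero_of_lineMeets {i j k : ZMod 5} (H : LineMeets 13 (pt i) (pt j) (pt k)) :
    i + j + k = 0 := by
  refine add_eq_zero_of_coord i j k (triple_coord_eq_zero H) (polar_coord_eq_zero H)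
    (polar_coord_eq_zero H.rotate) (polar_coord_eq_zero H.rotate.rotate) ?_
  rintro rfl rfl l hl
  exact eq_of_polar_coord_eq_zero H hl

theorem lineMeets_of_eq {i j k : ZMod 5} (u v : Fin 3 → ℤ) (a b c : Fin 2 → ℤ) (r : Fin 3 → ℤ) (K :
    ℤ)
    (huv : ∃ l l', u l * v l' - u l' * v l ≠ 0) (ha : a ≠ 0) (hb : b ≠ 0) (hc : c ≠ 0)
    (hP : ∀ l, a 0 * u l + a 1 * v l = r 0 * coord i l)
    (hQ : ∀ l, b 0 * u l + b 1 * v l = r 1 * coord j l)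
    (hR : ∀ l, c 0 * u l + c 1 * v l = r 2 * coord k l) (hK : K ≠ 0)
    (hF : ∀ s t : ℚ, cubic 13 (fun l => s * u l + t * v l) =
      K * (s * a 1 - t * a 0) * (s * b 1 - t * b 0) * (s * c 1 - t * c 0)) :
    LineMeets 13 (pt i) (pt j) (pt k) := by
  have cast_ne : ∀ a : Fin 2 → ℤ, a ≠ 0 → (fun l => (a l : ℚ)) ≠ 0 := fun a ha h0 =>
    ha (by funext l; simpa using congrFun h0 l)
  have mem : ∀ (a : Fin 2 → ℤ) (r : ℤ) (i : ZMod 5),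
      (∀ l, a 0 * u l + a 1 * v l = r * coord i l) →
      (a 0 : ℚ) • (fun l => (u l : ℚ)) + (a 1 : ℚ) • (fun l => (v l : ℚ)) ∈ (pt i).1.submodule :=
    fun a r i h => mem_pt.2 ⟨r, by
      funext l
      have := congrArg (Int.cast : ℤ → ℚ) (h l)
      push_cast at this
      simp [this]⟩
  refine ⟨fun l => u l, fun l => v l, ?_, fun l => a l, fun l => b l, fun l => c l, cast_ne a ha,
    cast_ne b hb, cast_ne c hc, mem a _ i hP, mem b _ j hQ, mem c _ k hR, K,
    Int.cast_ne_zero.2 hK, hF⟩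
  obtain ⟨l, l', h⟩ := huv
  have h' : (u l * v l' - u l' * v l : ℚ) ≠ 0 := by exact_mod_cast h
  refine LinearIndependent.pair_iff.2 fun s t hst => ?_
  have e1 := congrFun hst l
  have e2 := congrFun hst l'
  simp only [Pi.add_apply, Pi.smul_apply, smul_eq_mul, Pi.zero_apply] at e1 e2
  constructor
  · apply mul_right_cancel₀ h'
    linear_combination v l' * e1 - v l * e2
  · apply mul_right_cancel₀ h'
    linear_combination u l * e2 - u l' * e1

theorem lineMeets_one_four_zero : LineMeets 13 (pt 1) (pt 4) (pt 0) :=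
  lineMeets_of_eq ![0, 1, 0] ![1, 0, 0] ![1, 0] ![0, 1] ![-1, 1] ![1, 1, 1] (-1)
    (by decide) (by decide) (by decide) (by decide) (by decide) (by decide) (by decide)
    (by decide) (fun s t => by simp only [cubic, Matrix.cons_val]; push_cast; ring)

theorem lineMeets_two_three_zero : LineMeets 13 (pt 2) (pt 3) (pt 0) :=
  lineMeets_of_eq ![0, -1, 1] ![-1, 0, 1] ![1, 0] ![0, 1] ![1, -1] ![1, 1, 1] (-13)
    (by decide) (by decide) (by decide) (by decide) (by decide) (by decide) (by decide)
    (by decide) (fun s t => by simp only [cubic, Matrix.cons_val]; push_cast; ring)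

theorem lineMeets_one_two_two : LineMeets 13 (pt 1) (pt 2) (pt 2) :=
  lineMeets_of_eq ![0, 1, 0] ![0, -1, 1] ![1, 0] ![0, 1] ![0, 1] ![1, 1, 1] (-1)
    (by decide) (by decide) (by decide) (by decide) (by decide) (by decide) (by decide)
    (by decide) (fun s t => by simp only [cubic, Matrix.cons_val]; push_cast; ring)

theorem lineMeets_four_three_three : LineMeets 13 (pt 4) (pt 3) (pt 3) :=
  lineMeets_of_eq ![1, 0, 0] ![-1, 0, 1] ![1, 0] ![0, 1] ![0, 1] ![1, 1, 1] (-1)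
    (by decide) (by decide) (by decide) (by decide) (by decide) (by decide) (by decide)
    (by decide) (fun s t => by simp only [cubic, Matrix.cons_val]; push_cast; ring)

theorem lineMeets_three_one_one : LineMeets 13 (pt 3) (pt 1) (pt 1) :=
  lineMeets_of_eq ![-1, 0, 1] ![0, 1, 0] ![1, 0] ![0, 1] ![0, 1] ![1, 1, 1] (-13)
    (by decide) (by decide) (by decide) (by decide) (by decide) (by decide) (by decide)
    (by decide) (fun s t => by simp only [cubic, Matrix.cons_val]; push_cast; ring)

theorem lineMeets_two_four_four : LineMeets 13 (pt 2) (pt 4) (pt 4) :=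
  lineMeets_of_eq ![0, -1, 1] ![1, 0, 0] ![1, 0] ![0, 1] ![0, 1] ![1, 1, 1] (-13)
    (by decide) (by decide) (by decide) (by decide) (by decide) (by decide) (by decide)
    (by decide) (fun s t => by simp only [cubic, Matrix.cons_val]; push_cast; ring)

/-- The neutral element is a flex: its tangent is x + y = 12z, containing [12 : 0 : 1], and the
cubic restricts to 169t³ there. -/
theorem lineMeets_zero_zero_zero : LineMeets 13 (pt 0) (pt 0) (pt 0) :=
  lineMeets_of_eq ![1, -1, 0] ![12, 0, 1] ![1, 0] ![1, 0] ![1, 0] ![1, 1, 1] (-169)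
    (by decide) (by decide) (by decide) (by decide) (by decide) (by decide) (by decide)
    (by decide) (fun s t => by simp only [cubic, Matrix.cons_val]; push_cast; ring)

/-- A symmetric relation on triples that holds for these seven triples holds for all triples with
sum zero. -/
theorem forall_of_add_eq_zero {p : ZMod 5 → ZMod 5 → ZMod 5 → Prop}
    (hs : ∀ {i j k}, p i j k → p j i k) (hr : ∀ {i j k}, p i j k → p j k i) (h140 : p 1 4 0)
    (h230 : p 2 3 0) (h122 : p 1 2 2) (h433 : p 4 3 3) (h311 : p 3 1 1) (h244 : p 2 4 4)
    (h000 : p 0 0 0) (i j k : ZMod 5) (h : i + j + k = 0) : p i j k := by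
  obtain rfl : k = -(i + j) := by linear_combination h
  have key : ∀ i j : ZMod 5, ∃ t ∈ ([(1, 4, 0), (2, 3, 0), (1, 2, 2), (4, 3, 3), (3, 1, 1),
      (2, 4, 4), (0, 0, 0)] : List (ZMod 5 × ZMod 5 × ZMod 5)), t = (i, j, -(i + j)) ∨
      t = (j, -(i + j), i) ∨ t = (-(i + j), i, j) ∨ t = (j, i, -(i + j)) ∨
      t = (i, -(i + j), j) ∨ t = (-(i + j), j, i) := by decide
  obtain ⟨t, ht, hij⟩ := key i j
  have hp : p t.1 t.2.1 t.2.2 := by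
    simp only [List.mem_cons, List.not_mem_nil, or_false] at ht
    rcases ht with rfl | rfl | rfl | rfl | rfl | rfl | rfl <;> assumption
  rcases hij with rfl | rfl | rfl | rfl | rfl | rfl
  · exact hp
  · exact hr (hr hp)
  · exact hr hp
  · exact hs hp
  · exact hs (hr (hr hp))
  · exact hs (hr hp)

theorem lineMeets_pt_iff {i j k : ZMod 5} :
    LineMeets 13 (pt i) (pt j) (pt k) ↔ i + j + k = 0 :=
  ⟨add_eq_zero_of_lineMeets, forall_of_add_eq_zero (p := fun i j k =>
    LineMeets 13 (pt i) (pt j) (pt k)) LineMeets.swap LineMeets.rotate lineMeets_one_four_zero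
    lineMeets_two_three_zero lineMeets_one_two_two lineMeets_four_three_three
    lineMeets_three_one_one lineMeets_two_four_four lineMeets_zero_zero_zero i j k⟩

theorem pt_zero : pt 0 = O 13 :=
  Subtype.ext (by
    simp only [pt, O]
    congr 1
    funext j
    fin_cases j <;> simp [coord_zero])

/-- The parametrization of `E 13` by the cyclic group of order five. -/
noncomputable def equivZMod : E 13 ≃ ZMod 5 :=
  (Equiv.ofBijective pt ⟨pt_injective, pt_surjective⟩).symm

theorem pt_equivZMod (P : E 13) : pt (equivZMod P) = P :=
  (Equiv.ofBijective pt ⟨pt_injective, pt_surjective⟩).apply_symm_apply P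

theorem equivZMod_pt (i : ZMod 5) : equivZMod (pt i) = i :=
  (Equiv.ofBijective pt ⟨pt_injective, pt_surjective⟩).symm_apply_apply i

/-- The group is transported from ℤ/5 along the bijection with the five points, so associativity is
free and only the chord-tangent criterion has to be checked. Rank 0 holds because 5 kills
everything. -/
theorem exists_isChordTangentLaw : ∃ G : AddCommGroup (E 13), IsChordTangentLaw 13 G ∧
    Module.rank ℤ (E 13) = 0 ∧ Nonempty (E 13 ≃+ ZMod 5) := by
  let G : AddCommGroup (E 13) := equivZMod.addCommGroup
  have e : ∃ e : E 13 ≃+ ZMod 5, ∀ P, e P = equivZMod P := ⟨equivZMod.addEquiv, fun _ => rfl⟩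
  obtain ⟨e, he⟩ := e
  refine ⟨G, ⟨?_, fun P Q R => ?_⟩, ?_, ⟨e⟩⟩
  · apply e.injective
    rw [map_zero, he, ← pt_zero, equivZMod_pt]
  · rw [← pt_equivZMod P, ← pt_equivZMod Q, ← pt_equivZMod R, lineMeets_pt_iff,
      ← map_eq_zero_iff e e.injective, map_add, map_add]
    simp only [he, equivZMod_pt]
  · refine rank_eq_zero_iff.2 fun P => ⟨5, by norm_num, e.injective ?_⟩
    rw [map_zsmul, map_zero, zsmul_eq_mul]
    have : ((5 : ℤ) : ZMod 5) = 0 := by decide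
    rw [this, zero_mul]

theorem hcPlus_lt : hcPlus < ((13 : ℚ) : ℝ) := by
  have h : Real.sqrt 5 < 3 := (Real.sqrt_lt' (by norm_num)).2 (by norm_num)
  rw [hcPlus]
  push_cast
  linarith

end Lyness

theorem mainTheorem7 :
    (∃ h : ℚ, Lyness.hcPlus < (h : ℝ) ∧
      ∃ G : AddCommGroup (Lyness.E h), Lyness.IsChordTangentLaw h G ∧
        Module.rank ℤ (Lyness.E h) = 0) ∧
    (Lyness.hcPlus < ((13 : ℚ) : ℝ) ∧
      ∃ G : AddCommGroup (Lyness.E 13), Lyness.IsChordTangentLaw 13 G ∧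
        Module.rank ℤ (Lyness.E 13) = 0 ∧ Nonempty (Lyness.E 13 ≃+ ZMod 5)) ∧
    ¬ (∀ h : ℚ, Lyness.hcPlus < (h : ℝ) →
      ∀ G : AddCommGroup (Lyness.E h), Lyness.IsChordTangentLaw h G →
        0 < Module.rank ℤ (Lyness.E h)) := by
  obtain ⟨G, hG, hrank, he⟩ := Lyness.exists_isChordTangentLaw
  exact ⟨⟨13, Lyness.hcPlus_lt, G, hG, hrank⟩, ⟨Lyness.hcPlus_lt, G, hG, hrank, he⟩,
    fun H => (H 13 Lyness.hcPlus_lt G hG).ne' hrank⟩
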